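/- Let $Sol=\mathbb R\ltimes\mathbb R^2$ be the set of triples $(z,x,y)\in\mathbb R^3$ with product $(z,x,y)(z',x',y')=(z+z',\,x+e^{-z}x',\,y+e^{z}y')$, and let $d$ be the distance of the left-invariant Riemannian metric $ds^2=dz^2+e^{2z}dx^2+e^{-2z}dy^2$. Let $\mu$ be a countably supported probability measure on $Sol$ with finite first moment, i.e. $\int d(\mathrm{id},g)\,d\mu(g)<\infty$. Write $W_n=X_1\cdots X_n=(S_n,U_n,V_n)$, with $W_0=\mathrm{id}$ and $X_1,X_2,\dots$ independent of law $\mu$, for the associated random walk. The random walk has speed $v$ if $\frac1n d(\mathrm{id},W_n)\to v$ almost surely and $\frac1n\mathbb E\,d(\mathrm{id},W_n)\to v$. Let $m=\int z(g)\,d\mu(g)$ be the vertical drift. If $m>0$ (resp. $m<0$), the harmonic measure $\nu$ of $\mu$ is the law on $\mathbb R$ of the almost sure limit of $U_n$ (resp. of $V_n$); for $m=0$ no harmonic measure is defined. The measure $\mu$ is called non-degenerate (resp. non-degenerate on a subgroup $\Gamma$) if the semigroup generated by its support, i.e. by its set of atoms, is a group (resp. is $\Gamma$). (1) For every countable non-abelian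 subgroup $\Gamma$ of $Sol$ there is a probability measure $\mu$ with finite first moment, non-degenerate on $\Gamma$, with non-zero vertical drift, whose harmonic measure $\nu$ is non-atomic and singular with respect to Lebesgue measure on $\mathbb R$. (2) There is a finitely supported non-degenerate probability measure $\mu$ on $Sol$ with non-zero vertical drift whose harmonic measure is absolutely continuous with respect to Lebesgue measure. Moreover, for every $k\in\mathbb N$ there is a finitely supported non-degenerate probability measure $\mu$ on $Sol$ with non-zero vertical drift whose harmonic measure has a density of class $C^k$. (3) For every $\alpha>0$ there is a finitely supported non-degenerate probability measure $\mu$ on $Sol$ with non-zero vertical drift whose random walk has speed $\alpha$ and whose harmonic measure is non-atomic and singular with respect to Lebesgue measure. -/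

import Mathlib

open MeasureTheory Filter Topology

/-- The underlying space of the solvable Lie group Sol: points of `ℝ³` with
coordinates `(z, x, y)`. -/
@[ext]
structure Sol where
  z : ℝ
  x : ℝ
  y : ℝ

namespace Sol

/-- The group law of the semidirect product `ℝ ⋉ ℝ²`, `z.(x, y) = (e^{-z} x, e^{z} y)`. -/
noncomputable instance : Mul Sol :=
  ⟨fun g h => ⟨g.z + h.z, g.x + Real.exp (-g.z) * h.x, g.y + Real.exp g.z * h.y⟩⟩

noncomputable instance : One Sol := ⟨⟨0, 0, 0⟩⟩

noncomputable instance : Inv Sol :=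
  ⟨fun g => ⟨-g.z, -(Real.exp g.z * g.x), -(Real.exp (-g.z) * g.y)⟩⟩

theorem mul_def (g h : Sol) :
    g * h = ⟨g.z + h.z, g.x + Real.exp (-g.z) * h.x, g.y + Real.exp g.z * h.y⟩ := rfl

theorem one_def : (1 : Sol) = ⟨0, 0, 0⟩ := rfl

theorem inv_def (g : Sol) :
    g⁻¹ = ⟨-g.z, -(Real.exp g.z * g.x), -(Real.exp (-g.z) * g.y)⟩ := rfl

noncomputable instance : Group Sol :=
  Group.ofLeftAxioms
    (by
      intro a b c
      simp only [mul_def, Sol.mk.injEq, neg_add, Real.exp_add]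
      refine ⟨?_, ?_, ?_⟩ <;> ring)
    (by
      intro a
      simp [mul_def, one_def])
    (by
      intro a
      simp [mul_def, one_def, inv_def])

/-- The Borel σ-algebra of `ℝ³`. -/
instance : MeasurableSpace Sol :=
  MeasurableSpace.comap (fun g : Sol => (g.z, g.x, g.y)) inferInstance

/-- The length, over the parameter interval `[0, 1]`, of the curve `t ↦ (z t, x t, y t)` for the
left-invariant Riemannian metric `ds² = dz² + e^{2z} dx² + e^{-2z} dy²`. -/
noncomputable def curveLength (z x y : ℝ → ℝ) : ℝ :=
  ∫ t in (0 : ℝ)..1, Real.sqrt (deriv z t ^ 2 + Real.exp (2 * z t) * deriv x t ^ 2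
    + Real.exp (-(2 * z t)) * deriv y t ^ 2)

/-- The left-invariant Riemannian distance on Sol: the infimum of the lengths of the
`C¹` curves that join two points. -/
noncomputable def rdist (g h : Sol) : ℝ :=
  sInf {L : ℝ | ∃ z x y : ℝ → ℝ, ContDiff ℝ 1 z ∧ ContDiff ℝ 1 x ∧ ContDiff ℝ 1 y ∧
    (⟨z 0, x 0, y 0⟩ : Sol) = g ∧ (⟨z 1, x 1, y 1⟩ : Sol) = h ∧ L = curveLength z x y}

/-- The position `W_n = X_1 ⋯ X_n` of the walk with increments `X_{j+1} = ω j`, `W_0 = id`. -/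
noncomputable def walk (ω : ℕ → Sol) : ℕ → Sol
  | 0 => 1
  | n + 1 => walk ω n * ω n

/-! Countably supported probability measures on Sol are given by their mass functions `PMF Sol`;
`μ.support` is the set of atoms and `μ.toMeasure` the associated Borel measure. -/

/-- The law of the sequence of independent increments of law `μ`. -/
noncomputable def incrementLaw (μ : PMF Sol) : Measure (ℕ → Sol) :=
  Measure.infinitePi (fun _ : ℕ => μ.toMeasure)

/-- `μ` is non-degenerate on `Γ`: the semigroup generated by its support is the subgroup `Γ`. -/
def NonDegenerateOn (μ : PMF Sol) (Γ : Subgroup Sol) : Prop :=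
  (Subsemigroup.closure μ.support : Set Sol) = (Γ : Set Sol)

/-- `μ` is non-degenerate: the semigroup generated by its support is a subgroup of Sol. -/
def NonDegenerate (μ : PMF Sol) : Prop :=
  ∃ Γ : Subgroup Sol, NonDegenerateOn μ Γ

/-- `∫ d(id, g) dμ(g) < ∞`. -/
def HasFiniteFirstMoment (μ : PMF Sol) : Prop :=
  Integrable (fun g : Sol => rdist 1 g) μ.toMeasure

/-- The vertical drift: the mean of the `z`-component. -/
noncomputable def drift (μ : PMF Sol) : ℝ :=
  ∫ g : Sol, g.z ∂μ.toMeasure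

/-- `ν` is the harmonic measure of the random walk of law `μ`: if the vertical drift is positive,
it is the law of the almost sure limit of the `x`-coordinates of the walk; if the vertical drift is
negative, it is the law of the almost sure limit of the `y`-coordinates. There is no harmonic
measure for zero drift. -/
def IsHarmonicMeasure (μ : PMF Sol) (ν : Measure ℝ) : Prop :=
  (0 < drift μ ∧ ∃ ξ : (ℕ → Sol) → ℝ, Measurable ξ ∧
    (∀ᵐ ω ∂incrementLaw μ, Tendsto (fun n => (walk ω n).x) atTop (𝓝 (ξ ω))) ∧
    ν = (incrementLaw μ).map ξ) ∨
  (drift μ < 0 ∧ ∃ ξ : (ℕ → Sol) → ℝ, Measurable ξ ∧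
    (∀ᵐ ω ∂incrementLaw μ, Tendsto (fun n => (walk ω n).y) atTop (𝓝 (ξ ω))) ∧
    ν = (incrementLaw μ).map ξ)

/-- The random walk of law `μ` has speed `α`: `d(id, W_n) / n` tends to `α` in mean value
and almost surely. -/
def HasSpeed (μ : PMF Sol) (α : ℝ) : Prop :=
  (∀ n, Integrable (fun ω => rdist 1 (walk ω n)) (incrementLaw μ)) ∧
  Tendsto (fun n : ℕ => (∫ ω, rdist 1 (walk ω n) ∂incrementLaw μ) / n) atTop (𝓝 α) ∧
  ∀ᵐ ω ∂incrementLaw μ, Tendsto (fun n : ℕ => rdist 1 (walk ω n) / n) atTop (𝓝 α)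

end Sol

/-!
The action of Sol on the `x`-line (and, after inversion of the vertical axis, on the `y`-line) is by
affine maps, `g` acting as `t ↦ β g + e^{-ζ g} t`. If the drift `m = ∫ ζ dμ` is positive, the strong
law of large numbers shows that the translation parts `β (W_n)` converge at the exponential rate
`e^{-m n}` (`ae_exponential_convergence`), and the law of the limit is stationary
(`IsBoundaryMap.map_act`). Everything is then read off from this affine walk.

*Singularity.* If letters `g` have costs `c g` with `∑ e^{-c g} ≤ 1`, at most `e^{b n}` words of
length `n` cost at most `b n`. When `∫ c dμ < b < a < m`, the limit is eventually within `C e^{-a n}`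
of one of these `e^{b n}` points, so by the Borel-Cantelli lemma it lies in a Lebesgue null set
(`mutuallySingular_volume`). A law that gives mass `1 - ε` to one element with `ζ > 0` has a small
mean cost and a large drift (`exists_singular_of_perturb`). A stationary measure has no atoms as
soon as a translation is charged (`measure_singleton_eq_zero`).

*Smoothness.* Let the steps be `(± log 3, b, b)`, where the digit `b` is independent of the sign and
is a sum of `n` variables that are uniform on `{-1, 0, 1}`. At the first passages of the walk at the
heights `j log 3`, the digits contribute `∑ 3^{-j} b_j`, a sum of `n` independent variables that are
uniform on `[-3/2, 3/2]`, so the harmonic measure should be the convolution of the law of this sum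
with another probability measure. This is proved without conditioning on first passages: the second
factor is the harmonic measure of an explicit auxiliary walk, the convolution is stationary by a
computation with characteristic functions (`exists_map_eq_smear`), and stationary measures are unique
(`eq_map_of_stationary`). Convolution with `n + 2` uniform laws yields a density of class `C^n`
(`exists_contDiff_density`).

*Speed.* The vertical projection gives `|z| ≤ d(id, g)`; conversely, an explicit curve that climbs
slightly above the final height before it moves in the `y`-direction bounds `d(id, W_n)` by
`m n + o(n)` (`rdist_one_le`, `tendsto_rdist_walk`). So the speed is the drift, which is prescribed
freely by the choice of the translation length of the dominant step.
-/

namespace Sol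

/-! ### Measurability on Sol -/

theorem measurable_coord : Measurable fun g : Sol => (g.z, g.x, g.y) := comap_measurable _

theorem measurable_z : Measurable fun g : Sol => g.z := measurable_coord.fst

theorem measurable_x : Measurable fun g : Sol => g.x := measurable_coord.snd.fst

theorem measurable_y : Measurable fun g : Sol => g.y := measurable_coord.snd.snd

theorem measurable_of_coord {α : Type*} [MeasurableSpace α] {f : α → Sol}
    (hz : Measurable fun a => (f a).z) (hx : Measurable fun a => (f a).x)
    (hy : Measurable fun a => (f a).y) : Measurable f :=
  measurable_comap_iff.2 (hz.prodMk (hx.prodMk hy))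

instance : MeasurableSingletonClass Sol where
  measurableSet_singleton g := by
    have : ({g} : Set Sol) = (fun g : Sol => (g.z, g.x, g.y)) ⁻¹' {(g.z, g.x, g.y)} := by
      ext h
      simp [Sol.ext_iff]
    rw [this]
    exact measurable_coord (measurableSet_singleton _)

instance : MeasurableMul₂ Sol where
  measurable_mul := by
    have h1 : Measurable fun p : Sol × Sol => p.1 := measurable_fst
    have h2 : Measurable fun p : Sol × Sol => p.2 := measurable_snd
    apply measurable_of_coord
    · exact (measurable_z.comp h1).add (measurable_z.comp h2)
    · exact (measurable_x.comp h1).add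
        ((Real.measurable_exp.comp (measurable_z.comp h1).neg).mul (measurable_x.comp h2))
    · exact (measurable_y.comp h1).add
        ((Real.measurable_exp.comp (measurable_z.comp h1)).mul (measurable_y.comp h2))

/-! ### Discrete measures on Sol -/

section Discrete

variable (μ : PMF Sol)

theorem ae_mem_support : ∀ᵐ g ∂μ.toMeasure, g ∈ μ.support := by
  rw [ae_iff]
  have hm : MeasurableSet {g | g ∉ μ.support} := μ.support_countable.measurableSet.compl
  rw [PMF.toMeasure_apply_eq_zero_iff _ hm]
  exact Set.disjoint_left.2 fun g hg h => h hg

/-- Every function is almost everywhere measurable for a countably supported measure. -/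
theorem aemeasurable_toMeasure (f : Sol → ℝ) : AEMeasurable f μ.toMeasure := by
  refine ⟨μ.support.indicator f, ?_, ?_⟩
  · refine measurable_const.measurable_of_countable_ne (f := fun _ => (0 : ℝ)) ?_
    refine μ.support_countable.mono fun g hg => ?_
    by_contra h
    exact hg (by simp [h])
  · filter_upwards [ae_mem_support μ] with g hg
    simp [hg]

theorem integrable_of_finite_support (hμ : μ.support.Finite) (f : Sol → ℝ) :
    Integrable f μ.toMeasure := by
  obtain ⟨C, hC⟩ := (hμ.image fun g => ‖f g‖).bddAbove
  refine Integrable.of_bound (aemeasurable_toMeasure μ f).aestronglyMeasurable C ?_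
  filter_upwards [ae_mem_support μ] with g hg
  exact hC (Set.mem_image_of_mem _ hg)

end Discrete

/-! ### The law of the increments -/

/-- The sequence `g, ω 0, ω 1, …`. -/
def consSeq (g : Sol) (ω : ℕ → Sol) : ℕ → Sol
  | 0 => g
  | n + 1 => ω n

theorem measurable_consSeq : Measurable fun p : Sol × (ℕ → Sol) => consSeq p.1 p.2 := by
  refine measurable_pi_lambda _ fun n => ?_
  cases n with
  | zero => exact measurable_fst
  | succ n => exact (measurable_pi_apply n).comp measurable_snd

theorem consSeq_shift (ω : ℕ → Sol) : consSeq (ω 0) (fun n => ω (n + 1)) = ω := by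
  funext n
  cases n <;> rfl

instance (μ : PMF Sol) : IsProbabilityMeasure (incrementLaw μ) := by
  unfold incrementLaw
  infer_instance

/-- The first increment and the sequence of the later ones are independent, of laws `μ` and
`incrementLaw μ`. -/
theorem map_consSeq (μ : PMF Sol) :
    (μ.toMeasure.prod (incrementLaw μ)).map (fun p => consSeq p.1 p.2) = incrementLaw μ := by
  refine Measure.eq_infinitePi (fun _ : ℕ => μ.toMeasure) fun s t ht => ?_
  obtain ⟨N, hN⟩ := s.exists_nat_subset_range
  classical
  set t' : ℕ → Set Sol := fun i => if i ∈ s then t i else Set.univ with ht'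
  have ht'm : ∀ i, MeasurableSet (t' i) := fun i => by
    by_cases h : i ∈ s <;> simp [ht', h, ht]
  have h1 : Set.pi (s : Set ℕ) t = Set.pi (Finset.range (N + 1) : Set ℕ) t' := by
    ext ω
    simp only [Set.mem_pi, Finset.mem_coe, ht']
    refine ⟨fun h i _ => ?_, fun h i hi => ?_⟩
    · by_cases hi : i ∈ s <;> simp [hi, h]
    · have := h i (Finset.mem_range.2 (Nat.lt_succ_of_lt (Finset.mem_range.1 (hN hi))))
      simpa [hi] using this
  have h2 : ∏ i ∈ s, μ.toMeasure (t i) = ∏ i ∈ Finset.range (N + 1), μ.toMeasure (t' i) := by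
    rw [← Finset.prod_subset (s₁ := s) (f := fun i => μ.toMeasure (t' i))]
    · exact Finset.prod_congr rfl fun i hi => by simp [ht', hi]
    · exact hN.trans (Finset.range_mono (Nat.le_succ N))
    · intro i _ hi
      simp [ht', hi]
  rw [h1, h2, Measure.map_apply measurable_consSeq
    (MeasurableSet.pi (Finset.countable_toSet _) fun i _ => ht'm i)]
  have h3 : (fun p : Sol × (ℕ → Sol) => consSeq p.1 p.2) ⁻¹'
      Set.pi (Finset.range (N + 1) : Set ℕ) t' =
      t' 0 ×ˢ Set.pi (Finset.range N : Set ℕ) fun i => t' (i + 1) := by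
    ext ⟨g, ω⟩
    simp only [Set.mem_preimage, Set.mem_pi, Finset.mem_coe, Finset.mem_range, Set.mem_prod]
    constructor
    · intro h
      exact ⟨h 0 (Nat.succ_pos _), fun i hi => h (i + 1) (Nat.succ_lt_succ hi)⟩
    · rintro ⟨h0, h⟩ i hi
      cases i with
      | zero => exact h0
      | succ i => exact h i (Nat.lt_of_succ_lt_succ hi)
  rw [h3, Measure.prod_prod, incrementLaw, Measure.infinitePi_pi _ fun i _ => ht'm (i + 1),
    Finset.prod_range_succ', mul_comm]

theorem measurePreserving_shift (μ : PMF Sol) :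
    MeasurePreserving (fun (ω : ℕ → Sol) n => ω (n + 1)) (incrementLaw μ) (incrementLaw μ) :=
  ⟨measurable_pi_lambda _ fun _ => measurable_pi_apply _,
    Measure.map_infinitePi_infinitePi_of_inj (P := fun _ : ℕ => μ.toMeasure)
      (f := fun n => n + 1) (fun _ _ h => Nat.succ_injective h)⟩

theorem measurePreserving_eval (μ : PMF Sol) (n : ℕ) :
    MeasurePreserving (fun ω : ℕ → Sol => ω n) (incrementLaw μ) μ.toMeasure :=
  measurePreserving_eval_infinitePi (fun _ : ℕ => μ.toMeasure) n

/-- The head and the tail of the increments have the law `μ × incrementLaw μ`. -/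
theorem measurePreserving_head_tail (μ : PMF Sol) :
    MeasurePreserving (fun ω : ℕ → Sol => (ω 0, fun n => ω (n + 1))) (incrementLaw μ)
      (μ.toMeasure.prod (incrementLaw μ)) := by
  have hm : Measurable fun ω : ℕ → Sol => (ω 0, fun n => ω (n + 1)) :=
    (measurable_pi_apply 0).prodMk (measurable_pi_lambda _ fun n => measurable_pi_apply _)
  refine ⟨hm, ?_⟩
  conv_lhs => rw [← map_consSeq μ]
  rw [Measure.map_map hm measurable_consSeq]
  exact Measure.map_id

theorem ae_forall_mem_support (μ : PMF Sol) : ∀ᵐ ω ∂incrementLaw μ, ∀ n, ω n ∈ μ.support :=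
  ae_all_iff.2 fun n => (measurePreserving_eval μ n).quasiMeasurePreserving.ae (ae_mem_support μ)

/-- The strong law of large numbers for functions of the increments. -/
theorem strong_law (μ : PMF Sol) {f : Sol → ℝ} (hm : Measurable f)
    (hf : Integrable f μ.toMeasure) :
    ∀ᵐ ω ∂incrementLaw μ, Tendsto (fun n : ℕ => (∑ i ∈ Finset.range n, f (ω i)) / n) atTop
      (𝓝 (∫ g, f g ∂μ.toMeasure)) := by
  have hmp := measurePreserving_eval μ
  have h0 : ∫ ω, f (ω 0) ∂incrementLaw μ = ∫ g, f g ∂μ.toMeasure := by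
    rw [← (hmp 0).map_eq, integral_map (hmp 0).measurable.aemeasurable
      hm.aestronglyMeasurable]
  have hint : Integrable (fun ω : ℕ → Sol => f (ω 0)) (incrementLaw μ) :=
    (hmp 0).integrable_comp_of_integrable hf
  have hindep : Pairwise fun i j => ProbabilityTheory.IndepFun (fun ω : ℕ → Sol => f (ω i))
      (fun ω : ℕ → Sol => f (ω j)) (incrementLaw μ) := fun i j hij =>
    (ProbabilityTheory.iIndepFun_infinitePi (P := fun _ : ℕ => μ.toMeasure)
      (X := fun _ => f) fun _ => hm).indepFun hij
  have hid : ∀ i, (incrementLaw μ).map (fun ω => f (ω i)) = μ.toMeasure.map f := fun i => by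
    rw [← (hmp i).map_eq, Measure.map_map hm (hmp i).measurable]
    rfl
  have := ProbabilityTheory.strong_law_ae_real (μ := incrementLaw μ)
    (fun i (ω : ℕ → Sol) => f (ω i)) hint hindep fun i =>
      ⟨(hm.comp (hmp i).measurable).aemeasurable, (hm.comp (hmp 0).measurable).aemeasurable,
        (hid i).trans (hid 0).symm⟩
  rw [h0] at this
  exact this

/-! ### Affine actions on the line -/

/-- `(ζ, β)` defines an action of Sol on the line by the affine maps `t ↦ β g + e^{-ζ g} t`. The
two instances are `(z, x)`, for the action on the boundary of upward walks, and `(-z, y)`, for the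
action on the boundary of downward walks. -/
structure IsAffineAction (ζ β : Sol → ℝ) : Prop where
  measurable_log : Measurable ζ
  measurable_trans : Measurable β
  log_mul : ∀ g h, ζ (g * h) = ζ g + ζ h
  trans_mul : ∀ g h, β (g * h) = β g + Real.exp (-ζ g) * β h

theorem isAffineAction_z_x : IsAffineAction (fun g => g.z) fun g => g.x :=
  ⟨measurable_z, measurable_x, fun _ _ => rfl, fun _ _ => rfl⟩

theorem isAffineAction_neg_z_y : IsAffineAction (fun g => -g.z) fun g => g.y :=
  ⟨measurable_z.neg, measurable_y, fun g h => neg_add g.z h.z, fun g h => by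
    simp [mul_def]⟩

theorem measurable_walk (n : ℕ) : Measurable fun ω => walk ω n := by
  induction n with
  | zero => exact measurable_const
  | succ n ih => exact ih.mul (measurable_pi_apply n)

theorem walk_consSeq (g : Sol) (ω : ℕ → Sol) (n : ℕ) :
    walk (consSeq g ω) (n + 1) = g * walk ω n := by
  induction n with
  | zero => simp [walk, consSeq]
  | succ n ih =>
    rw [walk, ih, walk, mul_assoc]
    rfl

theorem walk_succ_eq (ω : ℕ → Sol) (n : ℕ) :
    walk ω (n + 1) = ω 0 * walk (fun k => ω (k + 1)) n := by
  conv_lhs => rw [← consSeq_shift ω]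
  exact walk_consSeq _ _ _

namespace IsAffineAction

variable {ζ β : Sol → ℝ} (h : IsAffineAction ζ β)
include h

theorem log_one : ζ 1 = 0 := by
  have := h.log_mul 1 1
  rw [mul_one] at this
  linarith

theorem trans_one : β 1 = 0 := by
  have := h.trans_mul 1 1
  rw [mul_one, h.log_one] at this
  simpa using this

theorem log_walk (ω : ℕ → Sol) (n : ℕ) : ζ (walk ω n) = ∑ i ∈ Finset.range n, ζ (ω i) := by
  induction n with
  | zero => simpa [walk] using h.log_one
  | succ n ih => rw [walk, h.log_mul, ih, Finset.sum_range_succ]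

theorem trans_walk_succ (ω : ℕ → Sol) (n : ℕ) :
    β (walk ω (n + 1)) =
      β (walk ω n) + Real.exp (-∑ i ∈ Finset.range n, ζ (ω i)) * β (ω n) := by
  rw [walk, h.trans_mul, h.log_walk]

end IsAffineAction

/-! ### Convergence to the boundary -/

/-- A series whose terms are `b n` discounted by `e^{-S n}`, with `S n ∼ m n` and `b n = o(n)`,
converges, exponentially fast at any rate `a < m`. -/
theorem exists_tendsto_of_discounted {u S b : ℕ → ℝ} {m a : ℝ}
    (hu : ∀ n, u (n + 1) = u n + Real.exp (-S n) * b n)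
    (hS : Tendsto (fun n : ℕ => S n / n) atTop (𝓝 m))
    (hb : Tendsto (fun n : ℕ => b n / n) atTop (𝓝 0)) (ha : 0 < a) (ham : a < m) :
    ∃ l, Tendsto u atTop (𝓝 l) ∧ ∃ C, ∀ᶠ n : ℕ in atTop, |u n - l| ≤ C * Real.exp (-(a * n)) := by
  set δ := (m - a) / 2 with hδ
  have hδ0 : 0 < δ := by linarith
  have e1 : ∀ᶠ n : ℕ in atTop, m - δ < S n / n := hS.eventually_const_lt (by linarith)
  have e2 : ∀ᶠ n : ℕ in atTop, |b n / n| < 1 := by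
    have := hb.abs
    rw [abs_zero] at this
    exact this.eventually_lt_const one_pos
  have key : ∀ᶠ n : ℕ in atTop, |u (n + 1) - u n| ≤ (1 / δ) * Real.exp (-(a * n)) := by
    filter_upwards [e1, e2, eventually_gt_atTop 0] with n h1 h2 hn
    have hn' : (0 : ℝ) < n := by exact_mod_cast hn
    rw [lt_div_iff₀ hn'] at h1
    rw [abs_div, abs_of_pos hn', div_lt_one hn'] at h2
    rw [hu n, add_sub_cancel_left, abs_mul, Real.abs_exp]
    -- Half of the gap `m - a` absorbs the deviation of `S n`, the other half the growth of `b n`.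
    have h3 : (n : ℝ) ≤ (1 / δ) * Real.exp (δ * n) := by
      have := Real.add_one_le_exp (δ * n)
      rw [div_mul_eq_mul_div, one_mul, le_div_iff₀ hδ0]
      linarith
    calc Real.exp (-S n) * |b n| ≤ Real.exp (-((m - δ) * n)) * ((1 / δ) * Real.exp (δ * n)) := by
          refine mul_le_mul ?_ (h2.le.trans h3) (abs_nonneg _) (Real.exp_nonneg _)
          exact Real.exp_le_exp.2 (by linarith)
      _ = (1 / δ) * Real.exp (-(a * n)) := by
          rw [mul_left_comm, ← Real.exp_add]
          congr 2
          rw [hδ]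
          ring
  obtain ⟨N, hN⟩ := eventually_atTop.1 key
  set r := Real.exp (-a) with hr
  have hr1 : r < 1 := by
    rw [hr, Real.exp_lt_one_iff]
    linarith
  have hpow : ∀ n : ℕ, Real.exp (-(a * n)) = r ^ n := fun n => by
    rw [hr, ← Real.exp_nat_mul]
    congr 1
    ring
  have hstep : ∀ n, dist (u (n + N)) (u (n + 1 + N)) ≤ (1 / δ * r ^ N) * r ^ n := fun n => by
    have := hN (n + N) (Nat.le_add_left _ _)
    rw [hpow, pow_add] at this
    rw [dist_comm, Real.dist_eq, show n + 1 + N = n + N + 1 by ring]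
    linarith
  obtain ⟨l, hl⟩ := cauchySeq_tendsto_of_complete (cauchySeq_of_le_geometric r _ hr1 hstep)
  refine ⟨l, (tendsto_add_atTop_iff_nat N).1 hl, 1 / δ / (1 - r), ?_⟩
  filter_upwards [eventually_ge_atTop N] with n hn
  have := dist_le_of_le_geometric_of_tendsto r _ hr1 hstep hl (n - N)
  rw [Nat.sub_add_cancel hn, Real.dist_eq, mul_assoc, ← pow_add, Nat.add_sub_cancel' hn] at this
  rw [hpow]
  calc _ ≤ _ := this
    _ = _ := by ring

theorem tendsto_div_of_sum {b : ℕ → ℝ} {l : ℝ}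
    (hb : Tendsto (fun n : ℕ => (∑ i ∈ Finset.range n, b i) / n) atTop (𝓝 l)) :
    Tendsto (fun n : ℕ => b n / n) atTop (𝓝 0) := by
  have h1 : Tendsto (fun n : ℕ => (∑ i ∈ Finset.range (n + 1), b i) / ((n + 1 : ℕ) : ℝ)
      * (((n + 1 : ℕ) : ℝ) / n)) atTop (𝓝 (l * 1)) := by
    refine ((tendsto_add_atTop_iff_nat 1).2 hb).mul ?_
    have : Tendsto (fun n : ℕ => 1 + 1 / (n : ℝ)) atTop (𝓝 (1 + 0)) :=
      tendsto_const_nhds.add tendsto_one_div_atTop_nhds_zero_nat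
    rw [add_zero] at this
    refine this.congr' ?_
    filter_upwards [eventually_gt_atTop 0] with n hn
    have hn' : (n : ℝ) ≠ 0 := by exact_mod_cast hn.ne'
    push_cast
    field_simp
  have h2 := h1.sub hb
  rw [mul_one, sub_self] at h2
  refine h2.congr fun n => ?_
  have : ((n + 1 : ℕ) : ℝ) ≠ 0 := by positivity
  rw [div_mul_div_cancel₀ this, Finset.sum_range_succ]
  ring

/-- `ξ` is a measurable version of the almost sure limit of the translation parts of the walk. -/
structure IsBoundaryMap (μ : PMF Sol) (β : Sol → ℝ) (ξ : (ℕ → Sol) → ℝ) : Prop where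
  measurable : Measurable ξ
  ae_tendsto : ∀ᵐ ω ∂incrementLaw μ, Tendsto (fun n => β (walk ω n)) atTop (𝓝 (ξ ω))

section Boundary

variable {ζ β : Sol → ℝ} (h : IsAffineAction ζ β) {μ : PMF Sol}
  (hζ : Integrable ζ μ.toMeasure) (hβ : Integrable β μ.toMeasure)
include h hζ hβ

theorem ae_exponential_convergence {a : ℝ} (ha : 0 < a) (ham : a < ∫ g, ζ g ∂μ.toMeasure) :
    ∀ᵐ ω ∂incrementLaw μ, ∃ l, Tendsto (fun n => β (walk ω n)) atTop (𝓝 l) ∧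
      ∃ C, ∀ᶠ n : ℕ in atTop, |β (walk ω n) - l| ≤ C * Real.exp (-(a * n)) := by
  filter_upwards [strong_law μ h.measurable_log hζ, strong_law μ h.measurable_trans hβ]
    with ω h1 h2
  exact exists_tendsto_of_discounted (h.trans_walk_succ ω) h1 (tendsto_div_of_sum h2) ha ham

theorem exists_isBoundaryMap (hm : 0 < ∫ g, ζ g ∂μ.toMeasure) : ∃ ξ, IsBoundaryMap μ β ξ := by
  obtain ⟨a, ha, ham⟩ := exists_between hm
  obtain ⟨ξ, h1, h2⟩ := measurable_limit_of_tendsto_metrizable_ae (μ := incrementLaw μ)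
    (L := atTop) (f := fun n ω => β (walk ω n))
    (fun n => (h.measurable_trans.comp (measurable_walk n)).aemeasurable)
    ((ae_exponential_convergence h hζ hβ ha ham).mono fun ω hω => ⟨_, hω.choose_spec.1⟩)
  exact ⟨ξ, h1, h2⟩

end Boundary

/-- The boundary point is equivariant: `ξ ω = ω₀ • ξ (ω₁, ω₂, …)`. -/
theorem IsBoundaryMap.ae_eq {ζ β : Sol → ℝ} (h : IsAffineAction ζ β) {μ : PMF Sol}
    {ξ : (ℕ → Sol) → ℝ} (hξ : IsBoundaryMap μ β ξ) :
    ∀ᵐ ω ∂incrementLaw μ, ξ ω = β (ω 0) + Real.exp (-ζ (ω 0)) * ξ fun n => ω (n + 1) := by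
  filter_upwards [hξ.ae_tendsto,
    (measurePreserving_shift μ).quasiMeasurePreserving.ae hξ.ae_tendsto] with ω h1 h2
  refine tendsto_nhds_unique ((tendsto_add_atTop_iff_nat 1).2 h1) ?_
  have : ∀ n, β (walk ω (n + 1)) =
      β (ω 0) + Real.exp (-ζ (ω 0)) * β (walk (fun k => ω (k + 1)) n) := fun n => by
    rw [walk_succ_eq, h.trans_mul]
  simp_rw [this]
  exact (h2.const_mul _).const_add _

theorem measurable_act {ζ β : Sol → ℝ} (h : IsAffineAction ζ β) :
    Measurable fun p : Sol × ℝ => β p.1 + Real.exp (-ζ p.1) * p.2 :=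
  (h.measurable_trans.comp measurable_fst).add
    ((Real.measurable_exp.comp (h.measurable_log.comp measurable_fst).neg).mul measurable_snd)

/-- The law of the boundary point is stationary. -/
theorem IsBoundaryMap.map_act {ζ β : Sol → ℝ} (h : IsAffineAction ζ β) {μ : PMF Sol}
    {ξ : (ℕ → Sol) → ℝ} (hξ : IsBoundaryMap μ β ξ) :
    (μ.toMeasure.prod ((incrementLaw μ).map ξ)).map
      (fun p => β p.1 + Real.exp (-ζ p.1) * p.2) = (incrementLaw μ).map ξ := by
  have e1 : μ.toMeasure.prod ((incrementLaw μ).map ξ) =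
      (μ.toMeasure.prod (incrementLaw μ)).map (Prod.map id ξ) := by
    rw [← Measure.map_prod_map _ _ measurable_id hξ.measurable, Measure.map_id]
  rw [e1, Measure.map_map (measurable_act h) (measurable_id.prodMap hξ.measurable),
    ← (measurePreserving_head_tail μ).map_eq, Measure.map_map
      ((measurable_act h).comp (measurable_id.prodMap hξ.measurable))
      (measurePreserving_head_tail μ).measurable]
  refine Measure.map_congr ?_
  filter_upwards [hξ.ae_eq h] with ω hω
  exact hω.symm

/-! ### Absence of atoms -/

theorem forall_of_ae_toMeasure {μ : PMF Sol} {p : Sol → Prop} (h : ∀ᵐ g ∂μ.toMeasure, p g)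
    {u : Sol} (hu : u ∈ μ.support) : p u := by
  by_contra hp
  have h1 : μ.toMeasure {u} = 0 := measure_mono_null (by simpa using hp) (ae_iff.1 h)
  rw [PMF.toMeasure_apply_singleton _ _ (measurableSet_singleton u)] at h1
  exact hu h1

/-- A stationary probability measure has no atom if `μ` charges a translation: the finitely many
atoms of maximal mass are permuted by the support of `μ`, and no finite set is invariant under a
translation. -/
theorem measure_singleton_eq_zero {ζ β : Sol → ℝ} (h : IsAffineAction ζ β) {μ : PMF Sol}
    {ν : Measure ℝ} [IsProbabilityMeasure ν]
    (hν : (μ.toMeasure.prod ν).map (fun p => β p.1 + Real.exp (-ζ p.1) * p.2) = ν)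
    {u : Sol} (hu : u ∈ μ.support) (hζu : ζ u = 0) (hβu : β u ≠ 0) (t : ℝ) : ν {t} = 0 := by
  by_contra ht
  have hfin : ∀ c : ENNReal, c ≠ 0 → {s : ℝ | c ≤ ν {s}}.Finite := fun c hc =>
    Measure.finite_const_le_meas_of_disjoint_iUnion ν (pos_iff_ne_zero.2 hc)
      (fun s => measurableSet_singleton s) (fun s s' hs => by simpa using hs) (measure_ne_top _ _)
  obtain ⟨s, hs, hmax⟩ := (hfin _ ht).exists_maximalFor (fun s => ν {s}) _ ⟨t, le_refl (ν {t})⟩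
  have hle : ∀ s', ν {s'} ≤ ν {s} := fun s' => by
    rcases le_total (ν {s'}) (ν {s}) with h1 | h1
    · exact h1
    · exact hmax (le_trans hs h1) h1
  have hst : ∀ r, ν {r} = ∫⁻ g, ν {Real.exp (ζ g) * (r - β g)} ∂μ.toMeasure := fun r => by
    conv_lhs => rw [← hν]
    rw [Measure.map_apply (measurable_act h) (measurableSet_singleton r),
      Measure.prod_apply (measurable_act h (measurableSet_singleton r))]
    refine lintegral_congr fun g => ?_
    congr 1
    ext x
    simp only [Set.mem_preimage, Set.mem_singleton_iff]
    constructor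
    · rintro rfl
      rw [add_sub_cancel_left, ← mul_assoc, ← Real.exp_add]
      simp
    · rintro rfl
      rw [← mul_assoc, ← Real.exp_add]
      simp
  -- The mass of a maximal atom is an average of masses that are at most maximal.
  have hstep : ∀ r, ν {r} = ν {s} → ν {r - β u} = ν {s} := fun r hr => by
    have hae : (fun g => ν {Real.exp (ζ g) * (r - β g)}) =ᵐ[μ.toMeasure] fun _ => ν {s} := by
      refine ae_eq_of_ae_le_of_lintegral_le (ae_of_all _ fun g => hle _) ?_
        aemeasurable_const ?_
      · rw [← hst]
        exact measure_ne_top _ _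
      · rw [← hst, hr]
        simp
    have := forall_of_ae_toMeasure hae hu
    simpa [hζu] using this
  have hall : ∀ n : ℕ, ν {s - n * β u} = ν {s} := fun n => by
    induction n with
    | zero => simp
    | succ n ih =>
      have := hstep _ ih
      rw [← this]
      push_cast
      ring_nf
  have hs0 : ν {s} ≠ 0 := fun h0 => ht (le_antisymm (h0 ▸ hle t) zero_le)
  refine Set.infinite_of_injective_forall_mem (f := fun n : ℕ => s - n * β u) ?_ ?_ (hfin _ hs0)
  · intro a b hab
    have : (a : ℝ) * β u = b * β u := by simpa using hab
    exact_mod_cast mul_right_cancel₀ hβu this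
  · intro n
    exact (hall n).ge

/-! ### Singularity -/

theorem walk_congr {ω ω' : ℕ → Sol} {n : ℕ} (h : ∀ i < n, ω i = ω' i) :
    walk ω n = walk ω' n := by
  induction n with
  | zero => rfl
  | succ n ih =>
    rw [walk, walk, ih fun i hi => h i (Nat.lt_succ_of_lt hi), h n (Nat.lt_succ_self n)]

theorem tsum_pi_prod {ι : Type*} (f : ι → ENNReal) (n : ℕ) :
    ∑' w : Fin n → ι, ∏ i, f (w i) = (∑' a, f a) ^ n := by
  induction n with
  | zero => simp
  | succ n ih =>
    rw [← (Fin.consEquiv fun _ => ι).tsum_eq, ENNReal.tsum_prod']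
    simp_rw [Fin.consEquiv_apply, Fin.prod_univ_succ, Fin.cons_zero, Fin.cons_succ,
      ENNReal.tsum_mul_left, ih, ENNReal.tsum_mul_right]
    rw [pow_succ']

/-- A word of length `n`, continued by the identity. -/
noncomputable def wordSeq {A : Set Sol} {n : ℕ} (w : Fin n → A) (i : ℕ) : Sol :=
  if hi : i < n then w ⟨i, hi⟩ else 1

/-- The union of the intervals of radius `r` around the translation parts of the words
`w` of length `n` and cost at most `l`. -/
noncomputable def wordCover (A : Set Sol) (β c : Sol → ℝ) (n : ℕ) (l r : ℝ) : Set ℝ :=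
  ⋃ w : {w : Fin n → A // ∑ i, c (w i) ≤ l},
    Metric.closedBall (β (walk (wordSeq w.1) n)) r

/-- If the costs satisfy Kraft's inequality, there are at most `e^l` words of cost at most `l`. -/
theorem volume_wordCover_le {A : Set Sol} (hA : A.Countable) (β : Sol → ℝ) {c : Sol → ℝ}
    (hc : ∑' g : A, ENNReal.ofReal (Real.exp (-c g)) ≤ 1) (n : ℕ) (l r : ℝ) :
    volume (wordCover A β c n l r) ≤ ENNReal.ofReal (2 * r) * ENNReal.ofReal (Real.exp l) := by
  have := hA.to_subtype
  calc volume (wordCover A β c n l r)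
      ≤ ∑' w : {w : Fin n → A // ∑ i, c (w i) ≤ l},
          volume (Metric.closedBall (β (walk (wordSeq w.1) n)) r) := measure_iUnion_le _
    _ ≤ ∑' w : {w : Fin n → A // ∑ i, c (w i) ≤ l}, ENNReal.ofReal (2 * r) *
          ENNReal.ofReal (Real.exp l) * ∏ i, ENNReal.ofReal (Real.exp (-c (w.1 i))) := by
        refine ENNReal.tsum_le_tsum fun w => ?_
        rw [Real.volume_closedBall, mul_assoc,
          ← ENNReal.ofReal_prod_of_nonneg fun i _ => Real.exp_nonneg _,
          ← ENNReal.ofReal_mul (Real.exp_nonneg _), ← Real.exp_sum, ← Real.exp_add]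
        refine le_mul_of_one_le_right' ?_
        rw [ENNReal.one_le_ofReal, Real.one_le_exp_iff, Finset.sum_neg_distrib]
        linarith [w.2]
    _ ≤ ∑' w : Fin n → A, ENNReal.ofReal (2 * r) *
          ENNReal.ofReal (Real.exp l) * ∏ i, ENNReal.ofReal (Real.exp (-c (w i))) :=
        ENNReal.tsum_comp_le_tsum_of_injective Subtype.val_injective _
    _ ≤ ENNReal.ofReal (2 * r) * ENNReal.ofReal (Real.exp l) := by
        rw [ENNReal.tsum_mul_left, tsum_pi_prod fun g : A => ENNReal.ofReal (Real.exp (-c g))]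
        exact mul_le_of_le_one_right' (pow_le_one₀ zero_le hc)

/-- If the mean `∫ c dμ` of a cost function subject to Kraft's inequality is smaller than the
drift, then the harmonic measure is singular: up to an error of order `e^{-a n}`, the boundary
point belongs to a set of `e^{b n}` points, with `b < a`. -/
theorem mutuallySingular_volume {ζ β : Sol → ℝ} (h : IsAffineAction ζ β) {μ : PMF Sol}
    (hζ : Integrable ζ μ.toMeasure) (hβ : Integrable β μ.toMeasure)
    {c : Sol → ℝ} (hcm : Measurable c) (hci : Integrable c μ.toMeasure)
    (hc : ∑' g : μ.support, ENNReal.ofReal (Real.exp (-c g)) ≤ 1)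
    (hm : 0 < ∫ g, ζ g ∂μ.toMeasure)
    (hlt : ∫ g, c g ∂μ.toMeasure < ∫ g, ζ g ∂μ.toMeasure)
    {ξ : (ℕ → Sol) → ℝ} (hξ : IsBoundaryMap μ β ξ) :
    (incrementLaw μ).map ξ ⟂ₘ (volume : Measure ℝ) := by
  obtain ⟨a, ha, ham⟩ := exists_between (max_lt hm hlt)
  obtain ⟨ha0, hca⟩ := max_lt_iff.1 ha
  obtain ⟨b, hcb, hba⟩ := exists_between hca
  set B : ℕ → ℕ → Set ℝ := fun K n =>
    wordCover μ.support β c n (b * n) (K * Real.exp (-(a * n))) with hB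
  have hvol : ∀ K, volume (limsup (B K) atTop) = 0 := fun K => by
    refine measure_limsup_atTop_eq_zero (ne_top_of_le_ne_top ?_ (ENNReal.tsum_le_tsum fun n =>
      volume_wordCover_le μ.support_countable β hc n (b * n) (K * Real.exp (-(a * n)))))
    have e1 : ∀ n : ℕ, ENNReal.ofReal (2 * (K * Real.exp (-(a * n)))) *
        ENNReal.ofReal (Real.exp (b * n)) =
        ENNReal.ofReal (2 * K * Real.exp (-(a - b)) ^ n) := fun n => by
      rw [← ENNReal.ofReal_mul (by positivity), ← Real.exp_nat_mul, mul_assoc, mul_assoc,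
        ← Real.exp_add, mul_assoc]
      congr 4
      ring
    simp_rw [e1]
    refine Summable.tsum_ofReal_ne_top ?_
    refine (summable_geometric_of_lt_one (Real.exp_nonneg _) ?_).mul_left _
    rw [Real.exp_lt_one_iff]
    linarith
  set N := toMeasurable volume (⋃ K, limsup (B K) atTop) with hN
  have hN0 : volume N = 0 := by
    rw [hN, measure_toMeasurable]
    exact measure_iUnion_null hvol
  have hNm : MeasurableSet N := measurableSet_toMeasurable _ _
  refine ⟨Nᶜ, hNm.compl, ?_, by rwa [compl_compl]⟩
  rw [Measure.map_apply hξ.measurable hNm.compl]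
  change ∀ᵐ ω ∂incrementLaw μ, ξ ω ∈ N
  filter_upwards [hξ.ae_tendsto, ae_exponential_convergence h hζ hβ ha0 ham,
    strong_law μ hcm hci, ae_forall_mem_support μ] with ω h1 h2 h3 h4
  obtain ⟨l, hl, C, hC⟩ := h2
  obtain rfl := tendsto_nhds_unique h1 hl
  -- The constant `C` depends on `ω`, so the null sets of all integer constants are joined.
  obtain ⟨K, hK⟩ := exists_nat_ge C
  refine subset_toMeasurable _ _ (Set.mem_iUnion.2 ⟨K, ?_⟩)
  rw [Filter.limsup_eq_iInf_iSup_of_nat]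
  simp only [Set.iInf_eq_iInter, Set.iSup_eq_iUnion, Set.mem_iInter]
  intro n₀
  have hev : ∀ᶠ n : ℕ in atTop, ξ ω ∈ B K n := by
    filter_upwards [hC, h3.eventually_lt_const hcb, eventually_gt_atTop 0] with n k1 k2 hn
    rw [div_lt_iff₀ (by exact_mod_cast hn)] at k2
    refine Set.mem_iUnion.2 ⟨⟨fun i => ⟨ω i, h4 i⟩, ?_⟩, ?_⟩
    · simpa [Finset.sum_range] using k2.le
    · rw [walk_congr (ω' := ω) fun i hi => by simp [wordSeq, hi], Metric.mem_closedBall,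
        Real.dist_eq, abs_sub_comm]
      exact k1.trans (mul_le_mul_of_nonneg_right hK (Real.exp_nonneg _))
  obtain ⟨n, hn, hn'⟩ := (hev.and (eventually_ge_atTop n₀)).exists
  exact Set.mem_iUnion₂.2 ⟨n, hn', hn⟩

/-! ### The Riemannian distance to the identity -/

theorem continuous_speed {z x y : ℝ → ℝ} (hz : ContDiff ℝ 1 z) (hx : ContDiff ℝ 1 x)
    (hy : ContDiff ℝ 1 y) : Continuous fun t => Real.sqrt (deriv z t ^ 2 +
      Real.exp (2 * z t) * deriv x t ^ 2 + Real.exp (-(2 * z t)) * deriv y t ^ 2) := by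
  have h1 := hz.continuous_deriv le_rfl
  have h2 := hx.continuous_deriv le_rfl
  have h3 := hy.continuous_deriv le_rfl
  have h4 := hz.continuous
  fun_prop

theorem curveLength_nonneg (z x y : ℝ → ℝ) : 0 ≤ curveLength z x y :=
  intervalIntegral.integral_nonneg zero_le_one fun _ _ => Real.sqrt_nonneg _

theorem rdist_le_curveLength {z x y : ℝ → ℝ} (hz : ContDiff ℝ 1 z) (hx : ContDiff ℝ 1 x)
    (hy : ContDiff ℝ 1 y) : rdist ⟨z 0, x 0, y 0⟩ ⟨z 1, x 1, y 1⟩ ≤ curveLength z x y := by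
  refine csInf_le ⟨0, ?_⟩ ⟨z, x, y, hz, hx, hy, rfl, rfl, rfl⟩
  rintro _ ⟨z, x, y, -, -, -, -, -, rfl⟩
  exact curveLength_nonneg z x y

theorem rdist_nonneg (g h : Sol) : 0 ≤ rdist g h := by
  refine Real.sInf_nonneg ?_
  rintro _ ⟨z, x, y, -, -, -, -, -, rfl⟩
  exact curveLength_nonneg z x y

/-- The projection to the vertical axis does not increase lengths. -/
theorem abs_z_le_rdist (g : Sol) : |g.z| ≤ rdist 1 g := by
  refine le_csInf ⟨_, fun t => t * g.z, fun t => t * g.x, fun t => t * g.y, by fun_prop,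
    by fun_prop, by fun_prop, by simp [one_def], by simp, rfl⟩ ?_
  rintro _ ⟨z, x, y, hz, hx, hy, h0, h1, rfl⟩
  have e0 : z 0 = 0 := congrArg Sol.z h0
  have e1 : z 1 = g.z := congrArg Sol.z h1
  have hi := (hz.continuous_deriv le_rfl).intervalIntegrable (μ := volume) 0 1
  have h2 : ∫ t in (0 : ℝ)..1, deriv z t = g.z := by
    rw [intervalIntegral.integral_deriv_eq_sub
      (fun t _ => (hz.differentiable one_ne_zero).differentiableAt) hi, e0, e1, sub_zero]
  rw [← h2]
  refine (intervalIntegral.abs_integral_le_integral_abs zero_le_one).trans ?_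
  refine intervalIntegral.integral_mono_on zero_le_one hi.abs
    ((continuous_speed hz hx hy).intervalIntegrable 0 1) fun t _ => ?_
  refine Real.abs_le_sqrt ?_
  have h3 : 0 ≤ Real.exp (2 * z t) * deriv x t ^ 2 := by positivity
  have h4 : 0 ≤ Real.exp (-(2 * z t)) * deriv y t ^ 2 := by positivity
  linarith

/-- A smooth function that increases from `0` to `1` on the interval `[i / 5, (i + 1) / 5]` and is
constant elsewhere. -/
noncomputable def ramp (i t : ℝ) : ℝ := Real.smoothTransition (5 * t - i)

theorem contDiff_ramp (i : ℝ) : ContDiff ℝ 1 (ramp i) :=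
  (Real.smoothTransition.contDiff (n := 1)).comp (by fun_prop : ContDiff ℝ 1 fun t => 5 * t - i)

theorem ramp_eq_zero {i t : ℝ} (h : 5 * t ≤ i) : ramp i t = 0 :=
  Real.smoothTransition.zero_of_nonpos (by linarith)

theorem ramp_eq_one {i t : ℝ} (h : i + 1 ≤ 5 * t) : ramp i t = 1 :=
  Real.smoothTransition.one_of_one_le (by linarith)

theorem deriv_ramp_nonneg (i t : ℝ) : 0 ≤ deriv (ramp i) t := by
  refine Monotone.deriv_nonneg (g := ramp i) fun s t hst => ?_
  exact Real.smoothTransition.monotone (by linarith)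

theorem mem_of_deriv_ramp_ne_zero {i t : ℝ} (h : deriv (ramp i) t ≠ 0) :
    i ≤ 5 * t ∧ 5 * t ≤ i + 1 := by
  constructor <;> by_contra! hlt
  · refine h ?_
    have : ramp i =ᶠ[𝓝 t] fun _ => 0 := by
      filter_upwards [eventually_lt_nhds (show t < i / 5 by linarith)] with s hs
      exact ramp_eq_zero (by linarith)
    rw [this.deriv_eq, deriv_const]
  · refine h ?_
    have : ramp i =ᶠ[𝓝 t] fun _ => 1 := by
      filter_upwards [eventually_gt_nhds (show (i + 1) / 5 < t by linarith)] with s hs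
      exact ramp_eq_one (by linarith)
    rw [this.deriv_eq, deriv_const]

theorem integral_deriv_ramp {i : ℝ} (h0 : 0 ≤ i) (h4 : i ≤ 4) :
    ∫ t in (0 : ℝ)..1, deriv (ramp i) t = 1 := by
  rw [intervalIntegral.integral_deriv_eq_sub
    (fun t _ => ((contDiff_ramp i).differentiable one_ne_zero).differentiableAt)
    (((contDiff_ramp i).continuous_deriv le_rfl).intervalIntegrable 0 1),
    ramp_eq_zero (t := 0) (by linarith),
    ramp_eq_one (t := 1) (by linarith), sub_zero]

theorem sqrt_le_add_add {a b c u v w : ℝ} (hu : |a| ≤ u) (hv : |b| ≤ v) (hw : |c| ≤ w) :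
    Real.sqrt (a ^ 2 + b ^ 2 + c ^ 2) ≤ u + v + w := by
  have h1 := (abs_nonneg a).trans hu
  have h2 := (abs_nonneg b).trans hv
  have h3 := (abs_nonneg c).trans hw
  refine Real.sqrt_le_iff.2 ⟨by positivity, ?_⟩
  have k1 := sq_le_sq' (abs_le.1 hu).1 (abs_le.1 hu).2
  have k2 := sq_le_sq' (abs_le.1 hv).1 (abs_le.1 hv).2
  have k3 := sq_le_sq' (abs_le.1 hw).1 (abs_le.1 hw).2
  nlinarith [mul_nonneg h1 h2, mul_nonneg h1 h3, mul_nonneg h2 h3]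

/-- The length of the curve that descends to the height `-a`, moves there in the `x`-direction,
ascends to the height `b`, moves there in the `y`-direction, and descends to `g`. -/
theorem rdist_one_le (g : Sol) {a b : ℝ} (ha : 0 ≤ a) (hb : 0 ≤ b) (hz : g.z ≤ b) :
    rdist 1 g ≤ 2 * a + 2 * b - g.z + Real.exp (-a) * |g.x| + Real.exp (-b) * |g.y| := by
  set z : ℝ → ℝ := fun t => -a * ramp 0 t + (a + b) * ramp 2 t + (g.z - b) * ramp 4 t with hzdef
  set x : ℝ → ℝ := fun t => g.x * ramp 1 t with hxdef
  set y : ℝ → ℝ := fun t => g.y * ramp 3 t with hydef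
  have hr : ∀ i, ContDiff ℝ 1 (ramp i) := contDiff_ramp
  have cz : ContDiff ℝ 1 z := by fun_prop
  have cx : ContDiff ℝ 1 x := by fun_prop
  have cy : ContDiff ℝ 1 y := by fun_prop
  have hd : ∀ i t, HasDerivAt (ramp i) (deriv (ramp i) t) t := fun i t =>
    ((hr i).differentiable one_ne_zero).differentiableAt.hasDerivAt
  have dz : ∀ t, deriv z t = -a * deriv (ramp 0) t + (a + b) * deriv (ramp 2) t
      + (g.z - b) * deriv (ramp 4) t := fun t =>
    ((((hd 0 t).const_mul (-a)).add ((hd 2 t).const_mul (a + b))).add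
      ((hd 4 t).const_mul (g.z - b))).deriv
  have dx : ∀ t, deriv x t = g.x * deriv (ramp 1) t := fun t => ((hd 1 t).const_mul g.x).deriv
  have dy : ∀ t, deriv y t = g.y * deriv (ramp 3) t := fun t => ((hd 3 t).const_mul g.y).deriv
  have h0 : (⟨z 0, x 0, y 0⟩ : Sol) = 1 := by
    have e : ∀ i : ℝ, 0 ≤ i → ramp i 0 = 0 := fun i hi => ramp_eq_zero (by linarith)
    simp [hzdef, hxdef, hydef, one_def, e]
  have h1 : (⟨z 1, x 1, y 1⟩ : Sol) = g := by
    have e : ∀ i : ℝ, i ≤ 4 → ramp i 1 = 1 := fun i hi => ramp_eq_one (by linarith)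
    ext
    · simp only [hzdef]
      rw [e 0 (by norm_num), e 2 (by norm_num), e 4 le_rfl]
      ring
    · simp only [hxdef]
      rw [e 1 (by norm_num), mul_one]
    · simp only [hydef]
      rw [e 3 (by norm_num), mul_one]
  have hle := rdist_le_curveLength cz cx cy
  rw [h0, h1] at hle
  refine hle.trans ?_
  have hcont : ∀ i, Continuous (deriv (ramp i)) := fun i => (hr i).continuous_deriv le_rfl
  have hpt : ∀ t ∈ Set.Icc (0 : ℝ) 1, Real.sqrt (deriv z t ^ 2 +
      Real.exp (2 * z t) * deriv x t ^ 2 + Real.exp (-(2 * z t)) * deriv y t ^ 2) ≤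
      (a * deriv (ramp 0) t + (a + b) * deriv (ramp 2) t + (b - g.z) * deriv (ramp 4) t) +
      (Real.exp (-a) * |g.x|) * deriv (ramp 1) t + (Real.exp (-b) * |g.y|) * deriv (ramp 3) t := by
    intro t _
    have e1 : Real.exp (2 * z t) * deriv x t ^ 2 = (Real.exp (z t) * deriv x t) ^ 2 := by
      rw [mul_pow, ← Real.exp_nat_mul]
      norm_num
    have e2 : Real.exp (-(2 * z t)) * deriv y t ^ 2 = (Real.exp (-z t) * deriv y t) ^ 2 := by
      rw [mul_pow, ← Real.exp_nat_mul]
      norm_num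
    rw [e1, e2]
    have p := fun i => deriv_ramp_nonneg i t
    refine sqrt_le_add_add ?_ ?_ ?_
    · rw [dz, abs_le]
      have k0 := mul_nonneg ha (p 0)
      have k2 := mul_nonneg (add_nonneg ha hb) (p 2)
      have k4 := mul_nonneg (sub_nonneg.2 hz) (p 4)
      constructor <;> linarith
    · rw [dx, abs_mul, Real.abs_exp, abs_mul, abs_of_nonneg (p 1)]
      by_cases hn : deriv (ramp 1) t = 0
      · simp [hn]
      obtain ⟨l1, l2⟩ := mem_of_deriv_ramp_ne_zero hn
      have : z t = -a := by
        simp only [hzdef]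
        rw [ramp_eq_one (i := 0) (by linarith), ramp_eq_zero (i := 2) (by linarith),
          ramp_eq_zero (i := 4) (by linarith)]
        ring
      rw [this, mul_assoc]
    · rw [dy, abs_mul, Real.abs_exp, abs_mul, abs_of_nonneg (p 3)]
      by_cases hn : deriv (ramp 3) t = 0
      · simp [hn]
      obtain ⟨l1, l2⟩ := mem_of_deriv_ramp_ne_zero hn
      have : z t = b := by
        simp only [hzdef]
        rw [ramp_eq_one (i := 0) (by linarith), ramp_eq_one (i := 2) (by linarith),
          ramp_eq_zero (i := 4) (by linarith)]
        ring
      rw [this, mul_assoc]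
  have hI : ∀ (c i : ℝ), IntervalIntegrable (fun t => c * deriv (ramp i) t) volume 0 1 :=
    fun c i => ((hcont i).const_mul c).intervalIntegrable 0 1
  refine (intervalIntegral.integral_mono_on zero_le_one
    ((continuous_speed cz cx cy).intervalIntegrable 0 1)
    (((((hI _ 0).add (hI _ 2)).add (hI _ 4)).add (hI _ 1)).add (hI _ 3)) hpt).trans ?_
  rw [intervalIntegral.integral_add ((((hI _ 0).add (hI _ 2)).add (hI _ 4)).add (hI _ 1))
      (hI _ 3), intervalIntegral.integral_add (((hI _ 0).add (hI _ 2)).add (hI _ 4)) (hI _ 1),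
    intervalIntegral.integral_add ((hI _ 0).add (hI _ 2)) (hI _ 4),
    intervalIntegral.integral_add (hI _ 0) (hI _ 2)]
  simp only [intervalIntegral.integral_const_mul]
  rw [integral_deriv_ramp le_rfl (by norm_num), integral_deriv_ramp zero_le_one (by norm_num),
    integral_deriv_ramp (by norm_num : (0 : ℝ) ≤ 2) (by norm_num),
    integral_deriv_ramp (by norm_num : (0 : ℝ) ≤ 3) (by norm_num),
    integral_deriv_ramp (by norm_num : (0 : ℝ) ≤ 4) le_rfl]
  linarith

/-! ### Speed -/

theorem aemeasurable_comp_walk (μ : PMF Sol) (f : Sol → ℝ) (n : ℕ) :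
    AEMeasurable (fun ω => f (walk ω n)) (incrementLaw μ) := by
  have := μ.support_countable.to_subtype
  set A : Set Sol := Set.range fun w : Fin n → μ.support => walk (wordSeq w) n with hA
  have hm : Measurable (A.indicator f) := by
    refine measurable_const.measurable_of_countable_ne (f := fun _ => (0 : ℝ)) ?_
    refine (Set.countable_range fun w : Fin n → μ.support => walk (wordSeq w) n).mono fun g hg => ?_
    by_contra h
    exact hg (by rw [Set.indicator_of_notMem h])
  refine ⟨_, hm.comp (measurable_walk n), ?_⟩
  filter_upwards [ae_forall_mem_support μ] with ω hω
  have : walk ω n ∈ A := by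
    refine ⟨fun i => ⟨ω i, hω i⟩, walk_congr fun i hi => ?_⟩
    simp [wordSeq, hi]
  simp [this]

theorem IsAffineAction.abs_trans_walk_le {ζ β : Sol → ℝ} (h : IsAffineAction ζ β) {C K : ℝ}
    {ω : ℕ → Sol} (hβ : ∀ i, |β (ω i)| ≤ C) {n : ℕ}
    (hζ : ∀ k < n, -∑ i ∈ Finset.range k, ζ (ω i) ≤ K) :
    |β (walk ω n)| ≤ n * (C * Real.exp K) := by
  induction n with
  | zero => simp [walk, h.trans_one]
  | succ n ih =>
    rw [h.trans_walk_succ]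
    refine (abs_add_le _ _).trans ?_
    rw [abs_mul, Real.abs_exp]
    have h1 := ih fun k hk => hζ k (Nat.lt_succ_of_lt hk)
    have h2 : Real.exp (-∑ i ∈ Finset.range n, ζ (ω i)) * |β (ω n)| ≤ Real.exp K * C :=
      mul_le_mul (Real.exp_le_exp.2 (hζ n (Nat.lt_succ_self n))) (hβ n) (abs_nonneg _)
        (Real.exp_nonneg _)
    push_cast
    linarith

theorem rdist_walk_le {C : ℝ} {ω : ℕ → Sol} (hz : ∀ i, |(ω i).z| ≤ C) (hx : ∀ i, |(ω i).x| ≤ C)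
    (hy : ∀ i, |(ω i).y| ≤ C) (n : ℕ) : rdist 1 (walk ω n) ≤ 7 * C * n := by
  have hC : 0 ≤ C := (abs_nonneg _).trans (hz 0)
  have hS : ∀ k, |∑ i ∈ Finset.range k, (ω i).z| ≤ C * k := fun k => by
    refine (Finset.abs_sum_le_sum_abs _ _).trans ((Finset.sum_le_sum fun i _ => hz i).trans ?_)
    simp [mul_comm]
  have hS' : ∀ k < n, |∑ i ∈ Finset.range k, (ω i).z| ≤ C * n := fun k hk =>
    (hS k).trans (mul_le_mul_of_nonneg_left (by exact_mod_cast hk.le) hC)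
  have h1 := isAffineAction_z_x.abs_trans_walk_le hx (n := n) (K := C * n)
    fun k hk => (neg_le_abs _).trans (hS' k hk)
  have h2 := isAffineAction_neg_z_y.abs_trans_walk_le hy (n := n) (K := C * n)
    fun k hk => by
      rw [Finset.sum_neg_distrib, neg_neg]
      exact (le_abs_self _).trans (hS' k hk)
  have hzn : |(walk ω n).z| ≤ C * n := by
    have := isAffineAction_z_x.log_walk ω n
    rw [this]
    exact hS n
  have hCn : 0 ≤ C * n := by positivity
  have hle := rdist_one_le (walk ω n) hCn hCn ((le_abs_self _).trans hzn)
  have hexp : ∀ u : ℝ, u ≤ n * (C * Real.exp (C * n)) → Real.exp (-(C * n)) * u ≤ C * n :=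
    fun u hu => by
      refine (mul_le_mul_of_nonneg_left hu (Real.exp_nonneg _)).trans (le_of_eq ?_)
      calc Real.exp (-(C * n)) * (n * (C * Real.exp (C * n)))
          = C * n * (Real.exp (-(C * n)) * Real.exp (C * n)) := by ring
        _ = C * n := by rw [← Real.exp_add, neg_add_cancel, Real.exp_zero, mul_one]
  have h3 := hexp _ h1
  have h4 := hexp _ h2
  have h5 := (neg_le_abs _).trans hzn
  linarith

/-- A path with bounded increments, vertical speed `m > 0` and bounded `x`-coordinates has linear
speed `m`: to reach `W_n` from the identity, it is enough to climb slightly above `m n`, where the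
distance to cover in the `y`-direction is bounded. -/
theorem tendsto_rdist_walk {C m : ℝ} (hm : 0 < m) {ω : ℕ → Sol} (hy : ∀ i, |(ω i).y| ≤ C)
    (hS : Tendsto (fun n : ℕ => (∑ i ∈ Finset.range n, (ω i).z) / n) atTop (𝓝 m))
    {l : ℝ} (hU : Tendsto (fun n => (walk ω n).x) atTop (𝓝 l)) :
    Tendsto (fun n : ℕ => rdist 1 (walk ω n) / n) atTop (𝓝 m) := by
  have hC : 0 ≤ C := (abs_nonneg _).trans (hy 0)
  have hz : ∀ n, (walk ω n).z = ∑ i ∈ Finset.range n, (ω i).z := isAffineAction_z_x.log_walk ω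
  refine tendsto_order.2 ⟨fun a ha => ?_, fun a ha => ?_⟩
  · filter_upwards [hS.eventually_const_lt ha] with n hn
    refine hn.trans_le (div_le_div_of_nonneg_right ?_ (Nat.cast_nonneg n))
    rw [← hz]
    exact (le_abs_self _).trans (abs_z_le_rdist _)
  · set δ := (a - m) / 6 with hδ
    have hδ0 : 0 < δ := by
      rw [hδ]
      linarith
    obtain ⟨N, hN⟩ := eventually_atTop.1 ((hS.eventually_lt_const (show m < m + δ by linarith)).and
      (eventually_gt_atTop 0))
    obtain ⟨K, hK⟩ : ∃ K, ∀ k, ∑ i ∈ Finset.range k, (ω i).z ≤ K + (m + δ) * k := by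
      obtain ⟨K, hK⟩ := ((Set.finite_Iio N).image fun k : ℕ =>
        ∑ i ∈ Finset.range k, (ω i).z).bddAbove
      refine ⟨max K 0, fun k => ?_⟩
      have hk0 : 0 ≤ (m + δ) * k := by positivity
      by_cases hk : k < N
      · have := hK (Set.mem_image_of_mem _ hk)
        linarith [le_max_left K 0]
      · obtain ⟨h1, h2⟩ := hN k (not_lt.1 hk)
        rw [div_lt_iff₀ (by exact_mod_cast h2)] at h1
        linarith [le_max_right K 0]
    have hV : ∀ n : ℕ, Real.exp (-((m + 2 * δ) * n)) * |(walk ω n).y| ≤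
        C * Real.exp K / δ := fun n => by
      have h1 := isAffineAction_neg_z_y.abs_trans_walk_le hy (n := n) (K := K + (m + δ) * n)
        fun k hk => by
          rw [Finset.sum_neg_distrib, neg_neg]
          refine (hK k).trans ?_
          have : (k : ℝ) ≤ n := by exact_mod_cast hk.le
          have := mul_le_mul_of_nonneg_left this (show 0 ≤ m + δ by linarith)
          linarith
      refine (mul_le_mul_of_nonneg_left h1 (Real.exp_nonneg _)).trans ?_
      have h2 : (n : ℝ) ≤ Real.exp (δ * n) / δ := by
        rw [le_div_iff₀ hδ0]
        linarith [Real.add_one_le_exp (δ * n)]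
      calc Real.exp (-((m + 2 * δ) * n)) * (n * (C * Real.exp (K + (m + δ) * n)))
          ≤ Real.exp (-((m + 2 * δ) * n)) *
            (Real.exp (δ * n) / δ * (C * Real.exp (K + (m + δ) * n))) := by gcongr
        _ = C / δ * (Real.exp (-((m + 2 * δ) * n)) * Real.exp (δ * n) *
              Real.exp (K + (m + δ) * n)) := by ring
        _ = C / δ * Real.exp K := by
            rw [← Real.exp_add, ← Real.exp_add]
            congr 2
            ring
        _ = C * Real.exp K / δ := by ring
    have hU' := hU.abs.eventually_lt_const (lt_add_one |l|)
    have hbig : ∀ᶠ n : ℕ in atTop, |l| + 1 + C * Real.exp K / δ < δ * n :=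
      (tendsto_natCast_atTop_atTop.const_mul_atTop hδ0).eventually_gt_atTop _
    filter_upwards [hU', hbig, eventually_gt_atTop 0, eventually_ge_atTop N,
      hS.eventually_const_lt (show m - δ < m by linarith)] with n h1 h2 hn hnN h3
    have hn' : (0 : ℝ) < n := by exact_mod_cast hn
    obtain ⟨h4, -⟩ := hN n hnN
    rw [div_lt_iff₀ hn', ← hz] at h4
    rw [lt_div_iff₀ hn', ← hz] at h3
    rw [div_lt_iff₀ hn']
    -- At the height `(m + 2 δ) n` the horizontal distance is bounded, and `W_n` lies below.
    have h5 := rdist_one_le (walk ω n) (a := 0) (b := (m + 2 * δ) * n) le_rfl (by positivity)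
      (by nlinarith)
    rw [neg_zero, Real.exp_zero, one_mul] at h5
    have h6 := hV n
    have h7 : a = m + 6 * δ := by
      rw [hδ]
      ring
    rw [h7]
    nlinarith

/-- The speed of a finitely supported walk with positive drift is its drift. -/
theorem hasSpeed_drift {μ : PMF Sol} (hμ : μ.support.Finite) (hm : 0 < drift μ) :
    HasSpeed μ (drift μ) := by
  obtain ⟨C, hC⟩ : ∃ C, ∀ g ∈ μ.support, |g.z| ≤ C ∧ |g.x| ≤ C ∧ |g.y| ≤ C := by
    obtain ⟨C, hC⟩ := (hμ.image fun g => max |g.z| (max |g.x| |g.y|)).bddAbove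
    refine ⟨C, fun g hg => ?_⟩
    have := hC (Set.mem_image_of_mem _ hg)
    exact ⟨(le_max_left _ _).trans this, ((le_max_left _ _).trans (le_max_right _ _)).trans this,
      ((le_max_right _ _).trans (le_max_right _ _)).trans this⟩
  have hint := integrable_of_finite_support μ hμ
  have hb : ∀ᵐ ω ∂incrementLaw μ, ∀ n, rdist 1 (walk ω n) ≤ 7 * C * n := by
    filter_upwards [ae_forall_mem_support μ] with ω hω
    exact rdist_walk_le (fun i => (hC _ (hω i)).1) (fun i => (hC _ (hω i)).2.1)
      fun i => (hC _ (hω i)).2.2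
  have hmeas := fun n => (aemeasurable_comp_walk μ (rdist 1) n).aestronglyMeasurable
  have hlim : ∀ᵐ ω ∂incrementLaw μ,
      Tendsto (fun n : ℕ => rdist 1 (walk ω n) / n) atTop (𝓝 (drift μ)) := by
    obtain ⟨a, ha, ham⟩ := exists_between hm
    filter_upwards [ae_forall_mem_support μ, strong_law μ measurable_z (hint _),
      ae_exponential_convergence isAffineAction_z_x (hint _) (hint _) ha ham] with ω h1 h2 h3
    obtain ⟨l, hl, -⟩ := h3
    exact tendsto_rdist_walk hm (fun i => (hC _ (h1 i)).2.2) h2 hl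
  refine ⟨fun n => ?_, ?_, hlim⟩
  · refine Integrable.of_bound (hmeas n) (7 * C * n) ?_
    filter_upwards [hb] with ω hω
    rw [Real.norm_of_nonneg (rdist_nonneg _ _)]
    exact hω n
  · have := tendsto_integral_of_dominated_convergence (μ := incrementLaw μ)
      (F := fun (n : ℕ) ω => rdist 1 (walk ω n) / n) (f := fun _ => drift μ) (fun _ => 7 * C)
      (fun n => (hmeas n).mul_const _) (integrable_const _) (fun n => ?_) hlim
    · simpa [integral_div] using this
    · filter_upwards [hb, ae_forall_mem_support μ] with ω hω h1
      have hC0 : 0 ≤ C := (abs_nonneg _).trans (hC _ (h1 0)).1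
      rw [Real.norm_of_nonneg (div_nonneg (rdist_nonneg _ _) (Nat.cast_nonneg n))]
      exact div_le_of_le_mul₀ (Nat.cast_nonneg n) (by positivity) (hω n)

/-! ### Mixtures of discrete laws -/

/-- The mixture `p μ + (1 - p) ν` of two discrete laws. -/
noncomputable def mix {α : Type*} (p : ENNReal) (hp : p ≤ 1) (μ ν : PMF α) : PMF α :=
  ⟨fun a => p * μ a + (1 - p) * ν a, by
    have h : ∑' a, (p * μ a + (1 - p) * ν a) = 1 := by
      rw [ENNReal.tsum_add, ENNReal.tsum_mul_left, ENNReal.tsum_mul_left, μ.tsum_coe, ν.tsum_coe,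
        mul_one, mul_one, add_tsub_cancel_of_le hp]
    have hs := ENNReal.summable (f := fun a => p * μ a + (1 - p) * ν a)
    have := hs.hasSum
    rwa [h] at this⟩

section Mix

variable {α : Type*} {p : ENNReal} (hp : p ≤ 1) (μ ν : PMF α)

theorem mix_apply (a : α) : mix p hp μ ν a = p * μ a + (1 - p) * ν a := rfl

theorem support_mix (h0 : p ≠ 0) (h1 : p ≠ 1) :
    (mix p hp μ ν).support = μ.support ∪ ν.support := by
  have h2 : 1 - p ≠ 0 := (tsub_pos_of_lt (lt_of_le_of_ne hp h1)).ne'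
  ext a
  simp only [PMF.mem_support_iff, mix_apply, Set.mem_union, ne_eq, add_eq_zero, mul_eq_zero, h0,
    h2, false_or]
  tauto

theorem toMeasure_mix [MeasurableSpace α] :
    (mix p hp μ ν).toMeasure = p • μ.toMeasure + (1 - p) • ν.toMeasure := by
  ext s hs
  rw [PMF.toMeasure_apply _ hs, Measure.add_apply, Measure.smul_apply, Measure.smul_apply,
    PMF.toMeasure_apply _ hs, PMF.toMeasure_apply _ hs, smul_eq_mul, smul_eq_mul,
    ← ENNReal.tsum_mul_left, ← ENNReal.tsum_mul_left, ← ENNReal.tsum_add]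
  refine tsum_congr fun a => ?_
  by_cases ha : a ∈ s <;> simp [ha, mix_apply]

variable {E : Type*} [NormedAddCommGroup E] [MeasurableSpace α]

theorem integrable_mix {f : α → E} (hμ : Integrable f μ.toMeasure)
    (hν : Integrable f ν.toMeasure) : Integrable f (mix p hp μ ν).toMeasure := by
  rw [toMeasure_mix]
  exact (hμ.smul_measure (ne_top_of_le_ne_top ENNReal.one_ne_top hp)).add_measure
    (hν.smul_measure (ENNReal.sub_ne_top ENNReal.one_ne_top))

theorem integral_mix [NormedSpace ℝ E] {f : α → E} (hμ : Integrable f μ.toMeasure)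
    (hν : Integrable f ν.toMeasure) : ∫ a, f a ∂(mix p hp μ ν).toMeasure =
      p.toReal • ∫ a, f a ∂μ.toMeasure + (1 - p.toReal) • ∫ a, f a ∂ν.toMeasure := by
  rw [toMeasure_mix, integral_add_measure
    (hμ.smul_measure (ne_top_of_le_ne_top ENNReal.one_ne_top hp))
    (hν.smul_measure (ENNReal.sub_ne_top ENNReal.one_ne_top)), integral_smul_measure,
    integral_smul_measure, ENNReal.toReal_sub_of_le hp ENNReal.one_ne_top, ENNReal.toReal_one]

end Mix

theorem toMeasure_map {α β : Type*} [MeasurableSpace α] [MeasurableSpace β] (μ : PMF α)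
    {f : α → β} (hf : Measurable f) : (μ.map f).toMeasure = μ.toMeasure.map f := by
  ext s hs
  rw [PMF.toMeasure_map_apply _ _ _ hf hs, Measure.map_apply hf hs]

theorem charFun_mix {p : ENNReal} (hp : p ≤ 1) (μ ν : PMF ℝ) (t : ℝ) :
    charFun (mix p hp μ ν).toMeasure t =
      p.toReal * charFun μ.toMeasure t + (1 - p.toReal) * charFun ν.toMeasure t := by
  have hi : ∀ μ : PMF ℝ, Integrable (fun x : ℝ => Complex.exp (t * x * Complex.I)) μ.toMeasure :=
    fun μ => Integrable.of_bound (by fun_prop) 1 (ae_of_all _ fun x => by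
      rw [← Complex.ofReal_mul, Complex.norm_exp_ofReal_mul_I])
  simp_rw [charFun_apply_real]
  rw [integral_mix hp μ ν (hi μ) (hi ν)]
  simp

/-! ### Stationary measures are unique -/

theorem norm_charFun_act_le (ζ β : Sol → ℝ) (ν : Measure ℝ) [IsProbabilityMeasure ν] (t : ℝ) (g : Sol) :
    ‖Complex.exp (t * β g * Complex.I) * charFun ν (Real.exp (-ζ g) * t)‖ ≤ 1 := by
  rw [norm_mul, ← Complex.ofReal_mul, Complex.norm_exp_ofReal_mul_I, one_mul]
  exact norm_charFun_le_one _

section Uniqueness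

variable {ζ β : Sol → ℝ} (h : IsAffineAction ζ β) {μ : PMF Sol}
include h

theorem measurable_charFun_act (ν : Measure ℝ) [IsFiniteMeasure ν] (t : ℝ) :
    Measurable fun g : Sol => Complex.exp (t * β g * Complex.I) *
      charFun ν (Real.exp (-ζ g) * t) := by
  have h1 := h.measurable_log
  have h2 := h.measurable_trans
  have h3 : Measurable (charFun ν) := stronglyMeasurable_charFun.measurable
  have h4 : Measurable fun g : Sol => Real.exp (-ζ g) * t := by fun_prop
  have h5 : Measurable fun g : Sol => Complex.exp (t * β g * Complex.I) := by fun_prop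
  exact h5.mul (h3.comp h4)

/-- Stationarity of a measure on the line, expressed by its characteristic function. -/
theorem charFun_of_map_act {ν : Measure ℝ} [IsProbabilityMeasure ν]
    (hν : (μ.toMeasure.prod ν).map (fun p => β p.1 + Real.exp (-ζ p.1) * p.2) = ν) (t : ℝ) :
    charFun ν t = ∫ g, Complex.exp (t * β g * Complex.I) *
      charFun ν (Real.exp (-ζ g) * t) ∂μ.toMeasure := by
  conv_lhs => rw [← hν]
  have hm : Measurable fun x : ℝ => Complex.exp (t * x * Complex.I) := by fun_prop
  rw [charFun_apply_real, integral_map (measurable_act h).aemeasurable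
    hm.aestronglyMeasurable, integral_prod]
  · refine integral_congr_ae (ae_of_all _ fun g => ?_)
    simp only
    rw [charFun_apply_real, ← integral_const_mul]
    refine integral_congr_ae (ae_of_all _ fun x => ?_)
    simp only
    rw [← Complex.exp_add]
    congr 1
    push_cast
    ring
  · refine Integrable.of_bound (hm.comp (measurable_act h)).aestronglyMeasurable 1
      (ae_of_all _ fun p => ?_)
    rw [← Complex.ofReal_mul, Complex.norm_exp_ofReal_mul_I]

theorem charFun_eq_integral_walk {ν : Measure ℝ} [IsProbabilityMeasure ν]
    (hν : ∀ t, charFun ν t = ∫ g, Complex.exp (t * β g * Complex.I) *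
      charFun ν (Real.exp (-ζ g) * t) ∂μ.toMeasure) (n : ℕ) (t : ℝ) :
    charFun ν t = ∫ ω, Complex.exp (t * β (walk ω n) * Complex.I) *
      charFun ν (Real.exp (-ζ (walk ω n)) * t) ∂incrementLaw μ := by
  induction n generalizing t with
  | zero => simp [walk, h.trans_one, h.log_one]
  | succ n ih =>
    have hm : Measurable fun ω : ℕ → Sol => Complex.exp (t * β (walk ω (n + 1)) * Complex.I) *
        charFun ν (Real.exp (-ζ (walk ω (n + 1))) * t) :=
      (measurable_charFun_act h ν t).comp (measurable_walk (n + 1))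
    conv_rhs => rw [← map_consSeq μ]
    rw [integral_map measurable_consSeq.aemeasurable hm.aestronglyMeasurable,
      integral_prod, hν t]
    · refine integral_congr_ae (ae_of_all _ fun g => ?_)
      simp only
      rw [ih, ← integral_const_mul]
      refine integral_congr_ae (ae_of_all _ fun ω => ?_)
      simp only
      rw [walk_consSeq, h.trans_mul, h.log_mul, ← mul_assoc, ← Complex.exp_add, ← mul_assoc,
        ← Real.exp_add]
      congr 2
      · push_cast
        ring
      · congr 2
        ring
    · exact Integrable.of_bound (hm.comp measurable_consSeq).aestronglyMeasurable 1
        (ae_of_all _ fun p => norm_charFun_act_le ζ β ν t _)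

/-- The harmonic measure is the only stationary probability measure: if `Z` is stationary and
independent of the walk, then `β (W_n) + e^{-ζ (W_n)} Z` has the law of `Z` and converges to the
boundary point. -/
theorem eq_map_of_stationary (hζ : Integrable ζ μ.toMeasure) (hm : 0 < ∫ g, ζ g ∂μ.toMeasure)
    {ξ : (ℕ → Sol) → ℝ} (hξ : IsBoundaryMap μ β ξ) {ν : Measure ℝ} [IsProbabilityMeasure ν]
    (hν : ∀ t, charFun ν t = ∫ g, Complex.exp (t * β g * Complex.I) *
      charFun ν (Real.exp (-ζ g) * t) ∂μ.toMeasure) :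
    ν = (incrementLaw μ).map ξ := by
  have := Measure.isProbabilityMeasure_map (μ := incrementLaw μ) hξ.measurable.aemeasurable
  refine Measure.ext_of_charFun (funext fun t => ?_)
  rw [charFun_apply_real (μ := (incrementLaw μ).map ξ),
    integral_map hξ.measurable.aemeasurable (by fun_prop)]
  have hlim := tendsto_integral_of_dominated_convergence (μ := incrementLaw μ)
    (F := fun n ω => Complex.exp (t * β (walk ω n) * Complex.I) *
      charFun ν (Real.exp (-ζ (walk ω n)) * t))
    (f := fun ω => Complex.exp (t * ξ ω * Complex.I)) (fun _ => 1)
    (fun n => ((measurable_charFun_act h ν t).comp (measurable_walk n)).aestronglyMeasurable)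
    (integrable_const _) (fun n => ae_of_all _ fun ω => norm_charFun_act_le ζ β ν t _) ?_
  · simp_rw [← charFun_eq_integral_walk h hν] at hlim
    exact tendsto_nhds_unique tendsto_const_nhds hlim
  · filter_upwards [hξ.ae_tendsto, strong_law μ h.measurable_log hζ] with ω h1 h2
    have h3 : Tendsto (fun n => ζ (walk ω n)) atTop atTop := by
      simp_rw [h.log_walk]
      refine (h2.pos_mul_atTop hm tendsto_natCast_atTop_atTop).congr' ?_
      filter_upwards [eventually_gt_atTop 0] with n hn
      exact div_mul_cancel₀ _ (by exact_mod_cast hn.ne')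
    have h4 : Tendsto (fun n => Real.exp (-ζ (walk ω n)) * t) atTop (𝓝 0) := by
      have := (Real.tendsto_exp_atBot.comp (tendsto_neg_atTop_atBot.comp h3)).mul_const t
      rwa [zero_mul] at this
    have h5 : Tendsto (fun n => charFun ν (Real.exp (-ζ (walk ω n)) * t)) atTop (𝓝 1) := by
      have h6 : charFun ν 0 = 1 := by simp
      rw [← h6]
      exact (continuous_charFun.tendsto 0).comp h4
    have h7 : Continuous fun x : ℝ => Complex.exp (t * x * Complex.I) := by fun_prop
    have := ((h7.tendsto (ξ ω)).comp h1).mul h5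
    rwa [mul_one] at this

end Uniqueness

/-! ### Convolution with uniform laws -/

/-- The uniform law on `[-3/2, 3/2]`. -/
noncomputable def unif : Measure ℝ :=
  ENNReal.ofReal (1 / 3) • volume.restrict (Set.Icc (-(3 / 2)) (3 / 2))

instance : IsProbabilityMeasure unif where
  measure_univ := by
    rw [unif, Measure.smul_apply, Measure.restrict_apply_univ, Real.volume_Icc, smul_eq_mul,
      ← ENNReal.ofReal_mul (by norm_num)]
    norm_num

theorem charFun_unif (t : ℝ) :
    charFun unif t = (1 / 3 : ℂ) * ∫ x in (-(3 / 2) : ℝ)..(3 / 2), Complex.exp (t * x * Complex.I) := by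
  rw [charFun_apply_real, unif, integral_smul_measure, integral_Icc_eq_integral_Ioc,
    ← intervalIntegral.integral_of_le (by norm_num), ENNReal.toReal_ofReal (by norm_num)]
  simp

/-- The characteristic function of the uniform law on `{-1, 0, 1}`. -/
noncomputable def ternaryChar (t : ℝ) : ℂ :=
  (Complex.exp (-(t * Complex.I)) + 1 + Complex.exp (t * Complex.I)) / 3

/-- The uniform law on `[-3/2, 3/2]` is self-similar: it is the convolution of its image under the
contraction of ratio `1/3` with the uniform law on `{-1, 0, 1}`. -/
theorem charFun_unif_eq (t : ℝ) : charFun unif t = ternaryChar t * charFun unif (t / 3) := by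
  rw [charFun_unif, charFun_unif]
  set F : ℝ → ℂ := fun x => Complex.exp (t * x * Complex.I) with hF
  have hi : ∀ a b, IntervalIntegrable F volume a b := fun a b =>
    (by fun_prop : Continuous F).intervalIntegrable a b
  have h1 : ∫ x in (-(3 / 2) : ℝ)..(3 / 2), Complex.exp (((t / 3 : ℝ) : ℂ) * x * Complex.I) =
      3 * ∫ x in (-(1 / 2) : ℝ)..(1 / 2), F x := by
    have := intervalIntegral.integral_comp_div (a := -(3 / 2)) (b := 3 / 2) F
      (three_ne_zero (α := ℝ))
    rw [show -(3 / 2) / 3 = (-(1 / 2) : ℝ) by norm_num, show 3 / 2 / 3 = (1 / 2 : ℝ) by norm_num,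
      Complex.real_smul] at this
    push_cast at this
    rw [← this]
    refine intervalIntegral.integral_congr fun x _ => ?_
    simp only [hF]
    congr 1
    push_cast
    ring
  have h2 : ∀ e : ℝ, Complex.exp (t * e * Complex.I) * ∫ x in (-(1 / 2) : ℝ)..(1 / 2), F x =
      ∫ x in (-(1 / 2) + e)..(1 / 2 + e), F x := fun e => by
    rw [← intervalIntegral.integral_comp_add_right F e, ← intervalIntegral.integral_const_mul]
    refine intervalIntegral.integral_congr fun x _ => ?_
    simp only [hF]
    rw [← Complex.exp_add]
    congr 1
    push_cast
    ring
  have h3 : ∫ x in (-(3 / 2) : ℝ)..(3 / 2), F x =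
      ternaryChar t * (3 * ∫ x in (-(1 / 2) : ℝ)..(1 / 2), F x) := by
    have k1 := h2 (-1)
    have k2 := h2 1
    rw [show (-(1 / 2) + -1 : ℝ) = -(3 / 2) by norm_num,
      show (1 / 2 + -1 : ℝ) = -(1 / 2) by norm_num] at k1
    rw [show (-(1 / 2) + 1 : ℝ) = 1 / 2 by norm_num,
      show (1 / 2 + 1 : ℝ) = 3 / 2 by norm_num] at k2
    rw [← intervalIntegral.integral_add_adjacent_intervals (hi _ (1 / 2)) (hi _ _),
      ← intervalIntegral.integral_add_adjacent_intervals (hi _ (-(1 / 2))) (hi _ _), ← k1, ← k2,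
      ternaryChar]
    push_cast
    simp only [mul_neg, mul_one, neg_mul]
    ring
  change 1 / 3 * (∫ x in (-(3 / 2) : ℝ)..(3 / 2), F x) = _
  rw [h1, h3]
  ring

/-- The convolution of `ρ` with `n` copies of the uniform law on `[-3/2, 3/2]`. -/
noncomputable def smear (ρ : Measure ℝ) : ℕ → Measure ℝ
  | 0 => ρ
  | n + 1 => (smear ρ n).conv unif

instance (ρ : Measure ℝ) [IsProbabilityMeasure ρ] (n : ℕ) : IsProbabilityMeasure (smear ρ n) := by
  induction n with
  | zero => assumption
  | succ n ih =>
    rw [smear]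
    infer_instance

theorem charFun_smear (ρ : Measure ℝ) [IsProbabilityMeasure ρ] (n : ℕ) (t : ℝ) :
    charFun (smear ρ n) t = charFun ρ t * charFun unif t ^ n := by
  induction n with
  | zero => simp [smear]
  | succ n ih => rw [smear, charFun_conv, ih, pow_succ, mul_assoc]

theorem conv_unif (ρ : Measure ℝ) [SFinite ρ] : ρ.conv unif =
    volume.withDensity fun y => ENNReal.ofReal (1 / 3) * ρ (Set.Icc (y - 3 / 2) (y + 3 / 2)) := by
  ext s hs
  have hind : Measurable (s.indicator (1 : ℝ → ENNReal)) := measurable_one.indicator hs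
  have hT : MeasurableSet {p : ℝ × ℝ | p.1 ∈ Set.Icc (p.2 - 3 / 2) (p.2 + 3 / 2)} := by
    have h1 : MeasurableSet {p : ℝ × ℝ | p.2 - 3 / 2 ≤ p.1} :=
      measurableSet_le (by fun_prop) (by fun_prop)
    have h2 : MeasurableSet {p : ℝ × ℝ | p.1 ≤ p.2 + 3 / 2} :=
      measurableSet_le (by fun_prop) (by fun_prop)
    exact h1.inter h2
  have e1 : ∀ x, ∫⁻ y, s.indicator 1 (x + y) ∂unif = ENNReal.ofReal (1 / 3) *
      ∫⁻ y, s.indicator 1 y * {p : ℝ × ℝ | p.1 ∈ Set.Icc (p.2 - 3 / 2) (p.2 + 3 / 2)}.indicator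
        (1 : ℝ × ℝ → ENNReal) (x, y) := fun x => by
    rw [unif, lintegral_smul_measure, smul_eq_mul, ← lintegral_indicator measurableSet_Icc,
      ← lintegral_add_left_eq_self
        (fun y => s.indicator 1 y * _) x]
    congr 1
    refine lintegral_congr fun y => ?_
    have : y ∈ Set.Icc (-(3 / 2) : ℝ) (3 / 2) ↔
        (x, x + y) ∈ {p : ℝ × ℝ | p.1 ∈ Set.Icc (p.2 - 3 / 2) (p.2 + 3 / 2)} := by
      simp only [Set.mem_Icc, Set.mem_ofPred_eq]
      constructor <;> rintro ⟨h1, h2⟩ <;> constructor <;> linarith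
    by_cases hy : y ∈ Set.Icc (-(3 / 2) : ℝ) (3 / 2)
    · rw [Set.indicator_of_mem hy, Set.indicator_of_mem (this.1 hy)]
      simp
    · rw [Set.indicator_of_notMem hy, Set.indicator_of_notMem fun h => hy (this.2 h)]
      simp
  rw [← lintegral_indicator_one hs, Measure.lintegral_conv hind]
  simp_rw [e1]
  rw [lintegral_const_mul' _ _ ENNReal.ofReal_ne_top, lintegral_lintegral_swap,
    withDensity_apply _ hs, ← lintegral_indicator hs, ← lintegral_const_mul' _ _
      ENNReal.ofReal_ne_top]
  · refine lintegral_congr fun y => ?_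
    rw [lintegral_const_mul' _ _ (by by_cases hy : y ∈ s <;> simp [hy])]
    have : ∫⁻ x, {p : ℝ × ℝ | p.1 ∈ Set.Icc (p.2 - 3 / 2) (p.2 + 3 / 2)}.indicator
        (1 : ℝ × ℝ → ENNReal) (x, y) ∂ρ = ρ (Set.Icc (y - 3 / 2) (y + 3 / 2)) := by
      rw [← lintegral_indicator_one measurableSet_Icc]
      rfl
    rw [this]
    by_cases hy : y ∈ s <;> simp [hy]
  · exact ((hind.comp measurable_snd).mul (measurable_one.indicator hT)).aemeasurable

theorem conv_unif_withDensity {f : ℝ → ℝ} (hf : ∀ a b, IntervalIntegrable f volume a b)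
    (h0 : ∀ t, 0 ≤ f t) [SFinite (volume.withDensity fun t => ENNReal.ofReal (f t))] :
    (volume.withDensity fun t => ENNReal.ofReal (f t)).conv unif =
      volume.withDensity fun y => ENNReal.ofReal (1 / 3 * ∫ x in (y - 3 / 2)..(y + 3 / 2), f x) := by
  rw [conv_unif]
  congr 1
  funext y
  rw [withDensity_apply _ measurableSet_Icc, intervalIntegral.integral_of_le (by linarith),
    ← integral_Icc_eq_integral_Ioc, ENNReal.ofReal_mul (by norm_num),
    ofReal_integral_eq_lintegral_ofReal _ (ae_of_all _ h0)]
  rw [← IntegrableOn, integrableOn_Icc_iff_integrableOn_Ioc,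
    ← intervalIntegrable_iff_integrableOn_Ioc_of_le (by linarith)]
  exact hf _ _

theorem integral_window_eq {f : ℝ → ℝ} (hf : ∀ a b, IntervalIntegrable f volume a b) (y : ℝ) :
    1 / 3 * ∫ x in (y - 3 / 2)..(y + 3 / 2), f x =
      1 / 3 * ((∫ x in (0 : ℝ)..(y + 3 / 2), f x) - ∫ x in (0 : ℝ)..(y - 3 / 2), f x) := by
  rw [intervalIntegral.integral_interval_sub_left (hf _ _) (hf _ _)]

theorem contDiff_primitive {f : ℝ → ℝ} {n : ℕ} (hf : ContDiff ℝ n f) :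
    ContDiff ℝ (n + 1 : ℕ) fun y => ∫ x in (0 : ℝ)..y, f x := by
  have hd : ∀ y, HasDerivAt (fun y => ∫ x in (0 : ℝ)..y, f x) (f y) y := fun y =>
    intervalIntegral.integral_hasDerivAt_right (hf.continuous.intervalIntegrable _ _)
      hf.continuous.stronglyMeasurable.stronglyMeasurableAtFilter hf.continuous.continuousAt
  have : deriv (fun y => ∫ x in (0 : ℝ)..y, f x) = f := funext fun y => (hd y).deriv
  rw [Nat.cast_add, Nat.cast_one, contDiff_succ_iff_deriv]
  refine ⟨fun y => (hd y).differentiableAt, fun hn => ?_, by rwa [this]⟩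
  exact absurd hn (by exact_mod_cast WithTop.natCast_ne_top n)

/-- Each convolution with the uniform law gains one degree of smoothness. -/
theorem exists_contDiff_density (ρ : Measure ℝ) [IsProbabilityMeasure ρ] (n : ℕ) :
    ∃ f : ℝ → ℝ, ContDiff ℝ n f ∧ (∀ t, 0 ≤ f t) ∧
      smear ρ (n + 2) = volume.withDensity fun t => ENNReal.ofReal (f t) := by
  induction n with
  | zero =>
    set f : ℝ → ℝ := fun y => 1 / 3 * ρ.real (Set.Icc (y - 3 / 2) (y + 3 / 2)) with hf
    have h0 : ∀ t, 0 ≤ f t := fun t => by positivity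
    have hfm : Measurable f := by
      have hT : MeasurableSet {p : ℝ × ℝ | p.2 ∈ Set.Icc (p.1 - 3 / 2) (p.1 + 3 / 2)} := by
        have h1 : MeasurableSet {p : ℝ × ℝ | p.1 - 3 / 2 ≤ p.2} :=
          measurableSet_le (by fun_prop) (by fun_prop)
        have h2 : MeasurableSet {p : ℝ × ℝ | p.2 ≤ p.1 + 3 / 2} :=
          measurableSet_le (by fun_prop) (by fun_prop)
        exact h1.inter h2
      exact (measurable_measure_prodMk_left (ν := ρ) hT).ennreal_toReal.const_mul _
    have hi : ∀ a b, IntervalIntegrable f volume a b := fun a b => by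
      refine (intervalIntegrable_const (c := (1 : ℝ))).mono_fun
        hfm.aestronglyMeasurable (ae_of_all _ fun t => ?_)
      simp only
      rw [Real.norm_of_nonneg (h0 t), norm_one]
      have : ρ.real (Set.Icc (t - 3 / 2) (t + 3 / 2)) ≤ 1 := measureReal_le_one
      rw [hf]
      linarith
    have h1 : smear ρ 1 = volume.withDensity fun t => ENNReal.ofReal (f t) := by
      rw [smear, smear, conv_unif]
      congr 1
      funext y
      rw [hf, ENNReal.ofReal_mul (by norm_num), ofReal_measureReal]
    have : SFinite (volume.withDensity fun t => ENNReal.ofReal (f t)) := h1 ▸ inferInstance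
    refine ⟨fun y => 1 / 3 * ∫ x in (y - 3 / 2)..(y + 3 / 2), f x, ?_, fun y => ?_, ?_⟩
    · simp_rw [integral_window_eq hi]
      have := intervalIntegral.continuous_primitive hi 0
      refine contDiff_zero.2 (continuous_const.mul ((this.comp ?_).sub (this.comp ?_))) <;>
        fun_prop
    · have : 0 ≤ ∫ x in (y - 3 / 2)..(y + 3 / 2), f x :=
        intervalIntegral.integral_nonneg (by linarith) fun t _ => h0 t
      positivity
    · rw [smear, h1, conv_unif_withDensity hi h0]
  | succ n ih =>
    obtain ⟨f, hf, h0, h1⟩ := ih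
    have hi : ∀ a b, IntervalIntegrable f volume a b := fun a b =>
      hf.continuous.intervalIntegrable a b
    have : SFinite (volume.withDensity fun t => ENNReal.ofReal (f t)) := h1 ▸ inferInstance
    refine ⟨fun y => 1 / 3 * ∫ x in (y - 3 / 2)..(y + 3 / 2), f x, ?_, fun y => ?_, ?_⟩
    · simp_rw [integral_window_eq hi]
      have := contDiff_primitive hf
      refine contDiff_const.mul ((this.comp ?_).sub (this.comp ?_)) <;> fun_prop
    · have : 0 ≤ ∫ x in (y - 3 / 2)..(y + 3 / 2), f x :=
        intervalIntegral.integral_nonneg (by linarith) fun t _ => h0 t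
      positivity
    · rw [show n + 1 + 2 = n + 2 + 1 by ring, smear, h1, conv_unif_withDensity hi h0]

/-! ### Semigroups that are groups -/

theorem nonDegenerate_of_inv_mem {μ : PMF Sol}
    (h : ∀ g ∈ μ.support, g⁻¹ ∈ Subsemigroup.closure μ.support) : NonDegenerate μ := by
  have hinv : ∀ g ∈ Subsemigroup.closure μ.support, g⁻¹ ∈ Subsemigroup.closure μ.support := by
    intro g hg
    induction hg using Subsemigroup.closure_induction with
    | mem g hg => exact h g hg
    | mul g g' _ _ h1 h2 =>
      rw [mul_inv_rev]
      exact mul_mem h2 h1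
  obtain ⟨g, hg⟩ := μ.support_nonempty
  have hg' := Subsemigroup.subset_closure hg
  refine ⟨{ Subsemigroup.closure μ.support with
    one_mem' := ?_
    inv_mem' := fun {g} hg => hinv g hg }, rfl⟩
  have := mul_mem hg' (hinv g hg')
  rwa [mul_inv_cancel] at this

/-! ### Digit laws -/

/-- The law of `X + c (ε₁ + ⋯ + εₙ)`, where `X` has law `d`, the digits `εᵢ` are uniform on
`{-1, 0, 1}`, and all these variables are independent. -/
noncomputable def addDigits (c : ℝ) (d : PMF ℝ) : ℕ → PMF ℝ
  | 0 => d
  | n + 1 => mix 3⁻¹ (by simp) ((addDigits c d n).map (· + -c))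
      (mix 2⁻¹ (by simp) (addDigits c d n) ((addDigits c d n).map (· + c)))

theorem charFun_addDigits (c : ℝ) (d : PMF ℝ) (n : ℕ) (t : ℝ) :
    charFun (addDigits c d n).toMeasure t = ternaryChar (c * t) ^ n * charFun d.toMeasure t := by
  induction n with
  | zero => simp [addDigits]
  | succ n ih =>
    rw [addDigits, charFun_mix, charFun_mix, toMeasure_map _ (by fun_prop),
      toMeasure_map _ (by fun_prop), charFun_map_add_const, charFun_map_add_const, ih,
      ternaryChar, pow_succ]
    have e1 : ((inner ℝ (-c) t : ℝ) : ℂ) * Complex.I = -(((c * t : ℝ) : ℂ) * Complex.I) := by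
      simp only [RCLike.inner_apply, conj_trivial]
      push_cast
      ring
    have e2 : ((inner ℝ c t : ℝ) : ℂ) * Complex.I = ((c * t : ℝ) : ℂ) * Complex.I := by
      simp only [RCLike.inner_apply, conj_trivial]
      push_cast
      ring
    rw [e1, e2]
    simp only [ENNReal.toReal_inv, ENNReal.toReal_ofNat]
    push_cast
    ring

theorem support_addDigits_succ (c : ℝ) (d : PMF ℝ) (n : ℕ) :
    (addDigits c d (n + 1)).support = (· + -c) '' (addDigits c d n).support ∪
      ((addDigits c d n).support ∪ (· + c) '' (addDigits c d n).support) := by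
  rw [addDigits, support_mix _ _ _ (by simp) (by simp), support_mix _ _ _ (by simp) (by simp),
    PMF.support_map, PMF.support_map]

theorem finite_support_addDigits (c : ℝ) {d : PMF ℝ} (hd : d.support.Finite) (n : ℕ) :
    (addDigits c d n).support.Finite := by
  induction n with
  | zero => exact hd
  | succ n ih =>
    rw [support_addDigits_succ]
    exact (ih.image _).union (ih.union (ih.image _))

theorem support_subset_addDigits (c : ℝ) (d : PMF ℝ) (n : ℕ) :
    d.support ⊆ (addDigits c d n).support := by
  induction n with
  | zero => exact subset_rfl
  | succ n ih =>
    rw [support_addDigits_succ]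
    exact fun b hb => Or.inr (Or.inl (ih hb))

theorem neg_mem_support_addDigits (c : ℝ) {d : PMF ℝ} (hd : ∀ b ∈ d.support, -b ∈ d.support)
    (n : ℕ) : ∀ b ∈ (addDigits c d n).support, -b ∈ (addDigits c d n).support := by
  induction n with
  | zero => exact hd
  | succ n ih =>
    rw [support_addDigits_succ]
    rintro _ (⟨b, hb, rfl⟩ | hb | ⟨b, hb, rfl⟩)
    · exact Or.inr (Or.inr ⟨-b, ih b hb, by dsimp only; ring⟩)
    · exact Or.inr (Or.inl (ih _ hb))
    · exact Or.inl ⟨-b, ih b hb, by dsimp only; ring⟩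

/-! ### A walk with a smooth harmonic measure -/

/-- The steps `(log 3, b, b)` with probability `2/3`, where `b` has law `d`, and
`(-log 3, b, b)` with probability `1/3`, where `b` has law `e`. -/
noncomputable def stepLaw (d e : PMF ℝ) : PMF Sol :=
  mix (ENNReal.ofReal (2 / 3)) (by rw [ENNReal.ofReal_le_one]; norm_num)
    (d.map fun b => ⟨Real.log 3, b, b⟩) (e.map fun b => ⟨-Real.log 3, b, b⟩)

theorem measurable_step (c : ℝ) : Measurable fun b : ℝ => (⟨c, b, b⟩ : Sol) :=
  measurable_of_coord measurable_const measurable_id measurable_id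

theorem support_stepLaw (d e : PMF ℝ) : (stepLaw d e).support =
    (fun b => (⟨Real.log 3, b, b⟩ : Sol)) '' d.support ∪
      (fun b => (⟨-Real.log 3, b, b⟩ : Sol)) '' e.support := by
  rw [stepLaw, support_mix, PMF.support_map, PMF.support_map]
  · rw [ne_eq, ENNReal.ofReal_eq_zero]
    norm_num
  · rw [ne_eq, ENNReal.ofReal_eq_one]
    norm_num

theorem finite_support_stepLaw {d e : PMF ℝ} (hd : d.support.Finite) (he : e.support.Finite) :
    (stepLaw d e).support.Finite := by
  rw [support_stepLaw]
  exact (hd.image _).union (he.image _)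

theorem integral_stepLaw (d e : PMF ℝ) {E : Type*} [NormedAddCommGroup E] [NormedSpace ℝ E]
    {F : Sol → E} (hF : StronglyMeasurable F) {C : ℝ}
    (hd : ∀ b, ‖F ⟨Real.log 3, b, b⟩‖ ≤ C) (he : ∀ b, ‖F ⟨-Real.log 3, b, b⟩‖ ≤ C) :
    ∫ g, F g ∂(stepLaw d e).toMeasure =
      (2 / 3 : ℝ) • ∫ b, F ⟨Real.log 3, b, b⟩ ∂d.toMeasure +
      (1 / 3 : ℝ) • ∫ b, F ⟨-Real.log 3, b, b⟩ ∂e.toMeasure := by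
  have hi : ∀ (c : ℝ) (d : PMF ℝ), (∀ b, ‖F ⟨c, b, b⟩‖ ≤ C) →
      Integrable F (d.map fun b => (⟨c, b, b⟩ : Sol)).toMeasure := fun c d h => by
    rw [toMeasure_map _ (measurable_step c),
      integrable_map_measure hF.aestronglyMeasurable (measurable_step c).aemeasurable]
    exact Integrable.of_bound (hF.comp_measurable (measurable_step c)).aestronglyMeasurable C
      (ae_of_all _ h)
  rw [stepLaw, integral_mix _ _ _ (hi _ _ hd) (hi _ _ he), toMeasure_map _ (measurable_step _),
    toMeasure_map _ (measurable_step _), integral_map (measurable_step _).aemeasurable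
    hF.aestronglyMeasurable, integral_map (measurable_step _).aemeasurable
    hF.aestronglyMeasurable, ENNReal.toReal_ofReal (by norm_num)]
  norm_num

theorem drift_stepLaw (d e : PMF ℝ) : drift (stepLaw d e) = Real.log 3 / 3 := by
  have hlog : 0 ≤ Real.log 3 := Real.log_nonneg (by norm_num)
  rw [drift, integral_stepLaw d e measurable_z.stronglyMeasurable (C := Real.log 3)
    (fun b => (Real.norm_of_nonneg hlog).le)
    (fun b => by simp only; rw [norm_neg, Real.norm_of_nonneg hlog])]
  simp only [integral_const, probReal_univ, smul_eq_mul]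
  ring

theorem drift_stepLaw_pos (d e : PMF ℝ) : 0 < drift (stepLaw d e) := by
  rw [drift_stepLaw]
  exact div_pos (Real.log_pos (by norm_num)) three_pos

theorem integral_charFun_stepLaw (d e : PMF ℝ) (ν : Measure ℝ) [IsProbabilityMeasure ν] (t : ℝ) :
    ∫ g : Sol, Complex.exp (t * g.x * Complex.I) * charFun ν (Real.exp (-g.z) * t)
        ∂(stepLaw d e).toMeasure =
      2 / 3 * (charFun d.toMeasure t * charFun ν (t / 3)) +
      1 / 3 * (charFun e.toMeasure t * charFun ν (3 * t)) := by
  have hb := norm_charFun_act_le (fun g : Sol => g.z) (fun g => g.x) ν t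
  rw [integral_stepLaw d e (measurable_charFun_act isAffineAction_z_x ν t).stronglyMeasurable
    (fun b => hb _) (fun b => hb _)]
  simp only [integral_mul_const, ← charFun_apply_real]
  rw [neg_neg, Real.exp_neg, Real.exp_log three_pos, inv_mul_eq_div, Complex.real_smul,
    Complex.real_smul]
  push_cast
  rfl

/-- The law of the sum of `n` independent digits. -/
noncomputable def digits (n : ℕ) : PMF ℝ := addDigits 1 (PMF.pure 0) n

/-- The walk with independent directions and digits is non-degenerate: its support contains
`(± log 3, 0, 0)`, and hence it generates the translations `(0, b, b)`, for a set of `b` that is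
symmetric. -/
theorem nonDegenerate_stepLaw (n : ℕ) : NonDegenerate (stepLaw (digits n) (digits n)) := by
  have h0 : (0 : ℝ) ∈ (digits n).support := support_subset_addDigits _ _ _ (by simp)
  have hneg : ∀ b ∈ (digits n).support, -b ∈ (digits n).support :=
    neg_mem_support_addDigits 1 (by simp) n
  set S := (stepLaw (digits n) (digits n)).support with hS
  have hup : ∀ b ∈ (digits n).support,
      (⟨Real.log 3, b, b⟩ : Sol) ∈ Subsemigroup.closure S := fun b hb =>
    Subsemigroup.subset_closure (by rw [hS, support_stepLaw]; exact Or.inl ⟨b, hb, rfl⟩)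
  have hdown : ∀ b ∈ (digits n).support,
      (⟨-Real.log 3, b, b⟩ : Sol) ∈ Subsemigroup.closure S := fun b hb =>
    Subsemigroup.subset_closure (by rw [hS, support_stepLaw]; exact Or.inr ⟨b, hb, rfl⟩)
  have htrans : ∀ b ∈ (digits n).support, (⟨0, b, b⟩ : Sol) ∈ Subsemigroup.closure S :=
    fun b hb => by
      have := mul_mem (hup b hb) (hdown 0 h0)
      simpa [mul_def] using this
  refine nonDegenerate_of_inv_mem fun g hg => ?_
  rw [support_stepLaw] at hg
  rcases hg with ⟨b, hb, rfl⟩ | ⟨b, hb, rfl⟩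
  · have := mul_mem (hdown 0 h0) (htrans (-b) (hneg b hb))
    simpa [mul_def, inv_def] using this
  · have := mul_mem (hup 0 h0) (htrans (-b) (hneg b hb))
    simpa [mul_def, inv_def] using this

/-- The harmonic measure of the walk with `n` digits is the convolution of `n` uniform laws with
another probability measure `ρ`. If `s` is the law of the sum of `n` uniform variables and `b` that of
the digits, then `s = b * s/3` and `3s = 3b * s`, where multiples denote images under scalings. So
`s * ρ` is stationary for the walk as soon as `ρ` is stationary for the walk with the steps
`(log 3, 0, 0)` and `(-log 3, b + 3b', b + 3b')`, where `b'` is an independent copy of `b`. -/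
theorem exists_map_eq_smear (n : ℕ) {ξ : (ℕ → Sol) → ℝ}
    (hξ : IsBoundaryMap (stepLaw (digits n) (digits n)) (fun g => g.x) ξ) :
    ∃ ρ : Measure ℝ, IsProbabilityMeasure ρ ∧
      (incrementLaw (stepLaw (digits n) (digits n))).map ξ = smear ρ n := by
  have hfin : (digits n).support.Finite := finite_support_addDigits 1 (by simp) n
  -- The law of `b + 3 b'`.
  set e := addDigits 3 (digits n) n with he
  have hfin' : (stepLaw (PMF.pure 0) e).support.Finite :=
    finite_support_stepLaw (by simp) (finite_support_addDigits 3 hfin n)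
  have hint' := integrable_of_finite_support _ hfin'
  have hint := integrable_of_finite_support _ (finite_support_stepLaw hfin hfin)
  obtain ⟨η, hη⟩ := exists_isBoundaryMap isAffineAction_z_x (hint' _) (hint' _)
    (drift_stepLaw_pos (PMF.pure 0) e)
  set ρ := (incrementLaw (stepLaw (PMF.pure 0) e)).map η with hρ
  have hprob : IsProbabilityMeasure ρ :=
    Measure.isProbabilityMeasure_map hη.measurable.aemeasurable
  refine ⟨ρ, hprob, ?_⟩
  have hst := charFun_of_map_act isAffineAction_z_x (hη.map_act isAffineAction_z_x)
  rw [← hρ] at hst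
  simp only [integral_charFun_stepLaw] at hst
  symm
  refine eq_map_of_stationary isAffineAction_z_x (hint _)
    (drift_stepLaw_pos (digits n) (digits n)) hξ fun t => ?_
  rw [integral_charFun_stepLaw, charFun_smear, charFun_smear, charFun_smear, hst t]
  have h1 : ∀ t, charFun (digits n).toMeasure t = ternaryChar t ^ n := fun t => by
    rw [digits, charFun_addDigits, PMF.toMeasure_pure, charFun_dirac]
    simp
  have h2 : charFun e.toMeasure t = ternaryChar (3 * t) ^ n * ternaryChar t ^ n := by
    rw [he, charFun_addDigits, h1]
  have h3 : charFun (PMF.pure (0 : ℝ)).toMeasure t = 1 := by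
    rw [PMF.toMeasure_pure, charFun_dirac]
    simp
  have h4 := charFun_unif_eq t
  have h5 := charFun_unif_eq (3 * t)
  rw [mul_div_cancel_left₀ t three_ne_zero] at h5
  rw [h1, h2, h3, h5, mul_pow, h4, mul_pow]
  ring

theorem exists_smooth_harmonic (k : ℕ) :
    ∃ (μ : PMF Sol) (ν : Measure ℝ), μ.support.Finite ∧ NonDegenerate μ ∧
      IsHarmonicMeasure μ ν ∧ ∃ f : ℝ → ℝ, ContDiff ℝ k f ∧ (∀ t, 0 ≤ f t) ∧
        ν = (volume : Measure ℝ).withDensity (fun t => ENNReal.ofReal (f t)) := by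
  have hfin : (digits (k + 2)).support.Finite := finite_support_addDigits 1 (by simp) _
  have hfin' := finite_support_stepLaw hfin hfin
  have hint := integrable_of_finite_support _ hfin'
  have hpos := drift_stepLaw_pos (digits (k + 2)) (digits (k + 2))
  obtain ⟨ξ, hξ⟩ := exists_isBoundaryMap isAffineAction_z_x (hint _) (hint _) hpos
  obtain ⟨ρ, hρ, he⟩ := exists_map_eq_smear (k + 2) hξ
  refine ⟨_, _, hfin', nonDegenerate_stepLaw _,
    Or.inl ⟨hpos, ξ, hξ.measurable, hξ.ae_tendsto, rfl⟩, ?_⟩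
  rw [he]
  exact exists_contDiff_density ρ k

/-! ### Walks of small entropy -/

/-- An upper bound for the mean cost of a step that is, with probability `1 - ε`, a fixed element of
cost `-log (1 - ε)`, and otherwise an element with an index `k` of mean at most `K` and a cost of
at most `-log (1 - ε) - log ε + (k + 1) log 2`. It tends to `0` with `ε`. -/
noncomputable def costBound (ε K : ℝ) : ℝ :=
  -Real.log (1 - ε) - ε * Real.log ε + ε * ((K + 1) * Real.log 2)

theorem exists_costBound_lt (K m D : ℝ) (hm : 0 < m) :
    ∃ ε, 0 < ε ∧ ε < 1 ∧ costBound ε K < (1 - ε) * m + ε * D := by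
  have hcont : ContinuousAt (fun ε => (1 - ε) * m + ε * D - costBound ε K) 0 := by
    have h1 : ContinuousAt (fun ε : ℝ => Real.log (1 - ε)) 0 :=
      ContinuousAt.log (by fun_prop) (by norm_num)
    have h2 : ContinuousAt (fun ε : ℝ => ε * Real.log ε) 0 :=
      Real.continuous_mul_log.continuousAt
    unfold costBound
    fun_prop
  have h0 : 0 < (fun ε => (1 - ε) * m + ε * D - costBound ε K) 0 := by
    simpa [costBound] using hm
  have hev := (hcont.eventually (lt_mem_nhds h0)).filter_mono (nhdsWithin_le_nhds (s := Set.Ioi 0))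
  obtain ⟨ε, h1, h2, h3⟩ := (hev.and ((eventually_mem_nhdsWithin).and
    ((eventually_lt_nhds (zero_lt_one' ℝ)).filter_mono nhdsWithin_le_nhds))).exists
  exact ⟨ε, h2, h3, by simpa using h1⟩

/-- The steps that are equal to `g` with probability `1 - ε`, and of law `ρ` otherwise. -/
noncomputable def perturb (g : Sol) (ρ : PMF Sol) (ε : ℝ) (hε : 0 < ε) : PMF Sol :=
  mix (ENNReal.ofReal (1 - ε)) (by rw [ENNReal.ofReal_le_one]; linarith) (PMF.pure g) ρ

section Perturb

variable {g : Sol} {ρ : PMF Sol} (hg : g ∈ ρ.support) {ε : ℝ} (hε : 0 < ε) (hε1 : ε < 1)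
theorem integrable_perturb {f : Sol → ℝ} (hf : Integrable f ρ.toMeasure) :
    Integrable f (perturb g ρ ε hε).toMeasure :=
  integrable_mix _ _ _ (integrable_of_finite_support _ (by simp) f) hf

include hε1

include hg in
theorem support_perturb : (perturb g ρ ε hε).support = ρ.support := by
  rw [perturb, support_mix, PMF.support_pure, Set.union_eq_right, Set.singleton_subset_iff]
  · exact hg
  · rw [ne_eq, ENNReal.ofReal_eq_zero]
    linarith
  · rw [ne_eq, ENNReal.ofReal_eq_one]
    linarith

theorem integral_perturb {f : Sol → ℝ} (hf : Integrable f ρ.toMeasure) :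
    ∫ h, f h ∂(perturb g ρ ε hε).toMeasure = (1 - ε) * f g + ε * ∫ h, f h ∂ρ.toMeasure := by
  rw [perturb, integral_mix _ _ _ (integrable_of_finite_support _ (by simp) f) hf,
    PMF.toMeasure_pure, integral_dirac, ENNReal.toReal_ofReal (by linarith), smul_eq_mul,
    smul_eq_mul, sub_sub_cancel]

/-- The cost of a step of the perturbed law, when `k` enumerates the support: the negative logarithm
of the weight `1 - ε` for `g`, and of the weight `ε 2^{-(k + 1)}` for the other elements. -/
noncomputable def cost (g : Sol) (k : Sol → ℕ) (ε : ℝ) (h : Sol) : ℝ :=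
  open scoped Classical in
  if h = g then -Real.log (1 - ε) else -Real.log ε + (k h + 1) * Real.log 2

omit hε1 in
theorem measurable_cost {k : Sol → ℕ} (hk : Measurable k) : Measurable (cost g k ε) := by
  classical
  have h1 : Measurable fun h => (k h : ℝ) := (measurable_of_countable fun n : ℕ => (n : ℝ)).comp hk
  refine Measurable.ite (measurableSet_singleton g) measurable_const ?_
  fun_prop

include hε in
/-- Kraft's inequality for the costs. -/
theorem tsum_exp_neg_cost_le {k : Sol → ℕ} {A : Set Sol} (hk : A.InjOn k) (hg : g ∈ A) :
    ∑' h : A, ENNReal.ofReal (Real.exp (-cost g k ε h)) ≤ 1 := by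
  classical
  have hpow : ∀ n : ℕ, Real.exp (-((n + 1 : ℝ) * Real.log 2)) = (1 / 2) ^ (n + 1) := fun n => by
    rw [Real.exp_neg, one_div, inv_pow, ← Real.rpow_natCast, Real.rpow_def_of_pos two_pos,
      mul_comm]
    push_cast
    rfl
  calc ∑' h : A, ENNReal.ofReal (Real.exp (-cost g k ε h))
      ≤ ∑' h : A, ((if h = ⟨g, hg⟩ then ENNReal.ofReal (1 - ε) else 0) +
          ENNReal.ofReal ε * ENNReal.ofReal ((1 / 2) ^ (k h + 1))) := by
        refine ENNReal.tsum_le_tsum fun h => ?_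
        by_cases hh : h = ⟨g, hg⟩
        · rw [if_pos hh, cost, if_pos (congrArg Subtype.val hh), neg_neg,
            Real.exp_log (by linarith)]
          exact le_self_add
        · have hne : (h : Sol) ≠ g := fun e => hh (Subtype.ext e)
          rw [if_neg hh, cost, if_neg hne, neg_add, neg_neg, Real.exp_add, Real.exp_log hε, hpow,
            zero_add, ENNReal.ofReal_mul hε.le]
    _ = ENNReal.ofReal (1 - ε) +
          ENNReal.ofReal ε * ∑' h : A, ENNReal.ofReal ((1 / 2) ^ (k h + 1)) := by
        rw [ENNReal.tsum_add, ENNReal.tsum_mul_left, tsum_ite_eq]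
    _ ≤ ENNReal.ofReal (1 - ε) + ENNReal.ofReal ε * 1 := by
        gcongr
        refine (ENNReal.tsum_comp_le_tsum_of_injective (f := fun h : A => k h)
          (fun a b hab => Subtype.ext (hk a.2 b.2 hab))
          fun n : ℕ => ENNReal.ofReal ((1 / 2) ^ (n + 1))).trans (le_of_eq ?_)
        rw [← ENNReal.ofReal_tsum_of_nonneg (fun n => by positivity)]
        · simp_rw [pow_succ, tsum_mul_right, tsum_geometric_two]
          norm_num
        · exact (summable_nat_add_iff 1).2 summable_geometric_two
    _ = 1 := by
        rw [mul_one, ← ENNReal.ofReal_add (by linarith) hε.le, sub_add_cancel, ENNReal.ofReal_one]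

theorem integral_cost_le {k : Sol → ℕ} (hk : Measurable k)
    (hki : Integrable (fun h => (k h : ℝ)) ρ.toMeasure) {K : ℝ}
    (hK : ∫ h, (k h : ℝ) ∂ρ.toMeasure ≤ K) :
    Integrable (cost g k ε) (perturb g ρ ε hε).toMeasure ∧
      ∫ h, cost g k ε h ∂(perturb g ρ ε hε).toMeasure ≤ costBound ε K := by
  have hlog1 : 0 ≤ -Real.log (1 - ε) := by
    have := Real.log_nonpos (x := 1 - ε) (by linarith) (by linarith)
    linarith
  have hlog2 : 0 ≤ -Real.log ε := by
    have := Real.log_nonpos hε.le hε1.le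
    linarith
  have hl2 : 0 ≤ Real.log 2 := Real.log_nonneg one_le_two
  have h0 : ∀ h, 0 ≤ cost g k ε h := fun h => by
    unfold cost
    split_ifs
    · exact hlog1
    · positivity
  have hle : ∀ h, cost g k ε h ≤
      (-Real.log (1 - ε) - Real.log ε + Real.log 2) + k h * Real.log 2 := fun h => by
    have : 0 ≤ (k h : ℝ) * Real.log 2 := by positivity
    unfold cost
    split_ifs <;> linarith
  have hbi : Integrable (fun h => (-Real.log (1 - ε) - Real.log ε + Real.log 2) +
      k h * Real.log 2) ρ.toMeasure := (integrable_const _).add (hki.mul_const _)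
  have hi : Integrable (cost g k ε) ρ.toMeasure :=
    hbi.mono' (measurable_cost hk).aestronglyMeasurable (ae_of_all _ fun h => by
      rw [Real.norm_of_nonneg (h0 h)]
      exact hle h)
  refine ⟨integrable_perturb hε hi, ?_⟩
  rw [integral_perturb hε hε1 hi]
  have h1 : ∫ h, cost g k ε h ∂ρ.toMeasure ≤
      (-Real.log (1 - ε) - Real.log ε + Real.log 2) + K * Real.log 2 := by
    refine (integral_mono hi hbi hle).trans ?_
    rw [integral_add (integrable_const _) (hki.mul_const _), integral_mul_const]
    simp only [integral_const, probReal_univ, one_smul]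
    have := mul_le_mul_of_nonneg_right hK hl2
    linarith
  have h2 : cost g k ε g = -Real.log (1 - ε) := by simp [cost]
  have h3 := mul_le_mul_of_nonneg_left h1 hε.le
  rw [h2, costBound]
  linarith

include hg in
/-- A walk that makes most of its steps along one element `g` has a non-atomic singular harmonic
measure. -/
theorem exists_singular_of_perturb {ζ β : Sol → ℝ} (h : IsAffineAction ζ β)
    (hζ : Integrable ζ ρ.toMeasure) (hβ : Integrable β ρ.toMeasure)
    {u : Sol} (hu : u ∈ ρ.support) (hζu : ζ u = 0) (hβu : β u ≠ 0)
    {k : Sol → ℕ} (hk : Measurable k) (hinj : ρ.support.InjOn k)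
    (hki : Integrable (fun h => (k h : ℝ)) ρ.toMeasure) {K : ℝ}
    (hK : ∫ h, (k h : ℝ) ∂ρ.toMeasure ≤ K)
    (hm : 0 < ∫ h, ζ h ∂(perturb g ρ ε hε).toMeasure)
    (hlt : costBound ε K < ∫ h, ζ h ∂(perturb g ρ ε hε).toMeasure) :
    ∃ ξ, IsBoundaryMap (perturb g ρ ε hε) β ξ ∧
      (∀ t, (incrementLaw (perturb g ρ ε hε)).map ξ {t} = 0) ∧
      (incrementLaw (perturb g ρ ε hε)).map ξ ⟂ₘ (volume : Measure ℝ) := by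
  have hs := support_perturb hg hε hε1
  have hζ' := integrable_perturb (g := g) hε hζ
  have hβ' := integrable_perturb (g := g) hε hβ
  obtain ⟨ξ, hξ⟩ := exists_isBoundaryMap h hζ' hβ' hm
  obtain ⟨hci, hc⟩ := integral_cost_le (g := g) hε hε1 hk hki hK
  have := Measure.isProbabilityMeasure_map (μ := incrementLaw (perturb g ρ ε hε))
    hξ.measurable.aemeasurable
  refine ⟨ξ, hξ, measure_singleton_eq_zero h (hξ.map_act h) (hs ▸ hu) hζu hβu,
    mutuallySingular_volume h hζ' hβ' (measurable_cost hk) hci ?_ hm (hc.trans_lt hlt) hξ⟩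
  rw [hs]
  exact tsum_exp_neg_cost_le hε hε1 hinj hg

end Perturb

/-! ### Singular harmonic measures on a given group -/

/-- Every countable nonempty set is the support of a probability measure that integrates a given
function. -/
theorem exists_support_eq {Γ : Set Sol} (hΓ : Γ.Countable) (hne : Γ.Nonempty) {F : Sol → ℝ}
    (hF : ∀ g, 0 ≤ F g) :
    ∃ ρ : PMF Sol, ρ.support = Γ ∧ Integrable F ρ.toMeasure := by
  classical
  have := hΓ.to_subtype
  obtain ⟨e, he⟩ := exists_injective_nat Γ
  -- The weights are summable even after multiplication by `1 + F`.
  set w : Sol → ENNReal := fun g =>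
    if hg : g ∈ Γ then ENNReal.ofReal ((1 / 2) ^ e ⟨g, hg⟩ / (1 + F g)) else 0 with hw
  have hpos : ∀ g, 0 < 1 + F g := fun g => by linarith [hF g]
  have hsupp : ∀ g, w g ≠ 0 ↔ g ∈ Γ := fun g => by
    by_cases hg : g ∈ Γ
    · simp only [hw, hg, dif_pos, iff_true]
      rw [ne_eq, ENNReal.ofReal_eq_zero, not_le]
      have := hpos g
      positivity
    · simp [hw, hg]
  have hgeom : ∑' g : Γ, ENNReal.ofReal ((1 / 2) ^ e g) ≠ ⊤ := by
    refine ne_top_of_le_ne_top ?_ (ENNReal.tsum_comp_le_tsum_of_injective he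
      fun n : ℕ => ENNReal.ofReal ((1 / 2) ^ n))
    exact summable_geometric_two.tsum_ofReal_ne_top
  have hle : ∀ g : Γ, w g * ENNReal.ofReal (1 + F g) = ENNReal.ofReal ((1 / 2) ^ e g) :=
    fun g => by
      simp only [hw, g.2, dif_pos]
      rw [← ENNReal.ofReal_mul (div_nonneg (by positivity) (hpos g).le),
        div_mul_cancel₀ _ (hpos g).ne']
  have hfin : ∑' g, w g ≠ ⊤ := by
    have : ∑' g, w g = ∑' g : Γ, w g := by
      refine (tsum_subtype_eq_of_support_subset fun g hg => (hsupp g).1 hg).symm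
    rw [this]
    refine ne_top_of_le_ne_top hgeom (ENNReal.tsum_le_tsum fun g => ?_)
    rw [← hle]
    exact le_mul_of_one_le_right' (by rw [ENNReal.one_le_ofReal]; linarith [hF g])
  have h0 : ∑' g, w g ≠ 0 := by
    obtain ⟨g, hg⟩ := hne
    intro h
    exact (hsupp g).2 hg (ENNReal.tsum_eq_zero.1 h g)
  have hs : (PMF.normalize w h0 hfin).support = Γ := by
    ext g
    rw [PMF.mem_support_normalize_iff]
    exact hsupp g
  refine ⟨PMF.normalize w h0 hfin, hs, (aemeasurable_toMeasure _ F).aestronglyMeasurable, ?_⟩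
  rw [hasFiniteIntegral_iff_ofReal (ae_of_all _ hF), ← PMF.restrict_toMeasure_support, hs,
    lintegral_countable _ hΓ]
  have hterm : ∀ g : Γ, ENNReal.ofReal (F g) * (PMF.normalize w h0 hfin).toMeasure {(g : Sol)} ≤
      (∑' g, w g)⁻¹ * ENNReal.ofReal ((1 / 2) ^ e g) := fun g => by
    rw [PMF.toMeasure_apply_singleton _ _ (measurableSet_singleton _), PMF.normalize_apply, ← hle]
    calc ENNReal.ofReal (F g) * (w g * (∑' g, w g)⁻¹)
        = (∑' g, w g)⁻¹ * (w g * ENNReal.ofReal (F g)) := by ring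
      _ ≤ _ := by
        gcongr
        linarith
  refine (ENNReal.tsum_le_tsum hterm).trans_lt ?_
  rw [ENNReal.tsum_mul_left]
  exact ENNReal.mul_lt_top (ENNReal.inv_ne_top.2 h0).lt_top hgeom.lt_top

/-- If two elements of a group have products with distinct translation parts, then the group
contains a translation and an expansion of the line. -/
theorem IsAffineAction.exists_trans_and_log {ζ β : Sol → ℝ} (h : IsAffineAction ζ β)
    {Γ : Subgroup Sol} {a b : Sol} (ha : a ∈ Γ) (hb : b ∈ Γ) (hab : β (a * b) ≠ β (b * a)) :
    (∃ u ∈ Γ, ζ u = 0 ∧ β u ≠ 0) ∧ ∃ g ∈ Γ, 0 < ζ g := by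
  have hinv : ∀ g, ζ g⁻¹ = -ζ g := fun g => by
    have := h.log_mul g g⁻¹
    rw [mul_inv_cancel, h.log_one] at this
    linarith
  constructor
  · set u := a * b * (b * a)⁻¹ with hu
    have hζu : ζ u = 0 := by
      rw [hu, h.log_mul, hinv, h.log_mul, h.log_mul]
      ring
    refine ⟨u, Γ.mul_mem (Γ.mul_mem ha hb) (Γ.inv_mem (Γ.mul_mem hb ha)), hζu, fun hβu => hab ?_⟩
    have h1 : a * b = u * (b * a) := by rw [hu, inv_mul_cancel_right]
    rw [h1, h.trans_mul, hζu, hβu]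
    simp
  · by_contra! hle
    have h0 : ∀ g ∈ Γ, ζ g = 0 := fun g hg => by
      have h1 := hle g hg
      have h2 := hle g⁻¹ (Γ.inv_mem hg)
      rw [hinv] at h2
      linarith
    apply hab
    rw [h.trans_mul, h.trans_mul, h0 a ha, h0 b hb]
    simp [add_comm]

theorem exists_singular_on {ζ β : Sol → ℝ} (h : IsAffineAction ζ β) {Γ : Subgroup Sol}
    (hΓ : (Γ : Set Sol).Countable) {a b : Sol} (ha : a ∈ Γ) (hb : b ∈ Γ)
    (hab : β (a * b) ≠ β (b * a)) :
    ∃ (μ : PMF Sol) (ξ : (ℕ → Sol) → ℝ), NonDegenerateOn μ Γ ∧ HasFiniteFirstMoment μ ∧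
      0 < ∫ g, ζ g ∂μ.toMeasure ∧ IsBoundaryMap μ β ξ ∧
      (∀ t : ℝ, (incrementLaw μ).map ξ {t} = 0) ∧
      (incrementLaw μ).map ξ ⟂ₘ (volume : Measure ℝ) := by
  classical
  obtain ⟨⟨u, hu, hζu, hβu⟩, g, hg, hgpos⟩ := h.exists_trans_and_log ha hb hab
  have := hΓ.to_subtype
  obtain ⟨e, he⟩ := exists_injective_nat (Γ : Set Sol)
  set k : Sol → ℕ := fun g => if hg : g ∈ (Γ : Set Sol) then e ⟨g, hg⟩ else 0 with hk
  have hkm : Measurable k := by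
    refine measurable_const.measurable_of_countable_ne (f := fun _ => (0 : ℕ))
      (hΓ.mono fun g hg => ?_)
    by_contra hn
    exact hg (by simp only [hk, hn, dif_neg, not_false_eq_true])
  -- One integrable function controls the moments, the distance and the index at once.
  obtain ⟨ρ, hρ, hint⟩ := exists_support_eq hΓ ⟨1, Γ.one_mem⟩
    (F := fun g => |ζ g| + |β g| + rdist 1 g + k g)
    fun g => by
      have := rdist_nonneg 1 g
      positivity
  have hdom : ∀ f : Sol → ℝ, (∀ g, |f g| ≤ |ζ g| + |β g| + rdist 1 g + k g) →
      Integrable f ρ.toMeasure := fun f hf =>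
    hint.mono' (aemeasurable_toMeasure ρ f).aestronglyMeasurable (ae_of_all _ hf)
  have hnn : ∀ g, 0 ≤ |ζ g| ∧ 0 ≤ |β g| ∧ 0 ≤ rdist 1 g ∧ (0 : ℝ) ≤ k g := fun g =>
    ⟨abs_nonneg _, abs_nonneg _, rdist_nonneg 1 g, Nat.cast_nonneg _⟩
  have hζ : Integrable ζ ρ.toMeasure := hdom _ fun g => by
    obtain ⟨_, _, _, _⟩ := hnn g
    linarith
  have hβ : Integrable β ρ.toMeasure := hdom _ fun g => by
    obtain ⟨_, _, _, _⟩ := hnn g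
    linarith
  have hd : Integrable (rdist 1) ρ.toMeasure := hdom _ fun g => by
    obtain ⟨_, _, h3, _⟩ := hnn g
    rw [abs_of_nonneg h3]
    linarith
  have hki : Integrable (fun g => (k g : ℝ)) ρ.toMeasure := hdom _ fun g => by
    obtain ⟨_, _, _, h4⟩ := hnn g
    rw [abs_of_nonneg h4]
    linarith
  obtain ⟨ε, hε, hε1, hlt⟩ := exists_costBound_lt (∫ g, (k g : ℝ) ∂ρ.toMeasure) (ζ g)
    (∫ g, ζ g ∂ρ.toMeasure) hgpos
  rw [← integral_perturb (g := g) hε hε1 hζ] at hlt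
  have hg' : g ∈ ρ.support := by rwa [hρ]
  have hm : 0 < ∫ h, ζ h ∂(perturb g ρ ε hε).toMeasure := by
    refine lt_of_le_of_lt ?_ hlt
    have h1 := Real.log_nonpos (x := 1 - ε) (by linarith) (by linarith)
    have h2 := mul_nonpos_of_nonneg_of_nonpos hε.le (Real.log_nonpos hε.le hε1.le)
    have h3 : 0 ≤ ∫ g, (k g : ℝ) ∂ρ.toMeasure := integral_nonneg fun g => Nat.cast_nonneg _
    have h4 : 0 ≤ ε * ((∫ g, (k g : ℝ) ∂ρ.toMeasure + 1) * Real.log 2) := by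
      have := Real.log_nonneg one_le_two
      positivity
    unfold costBound
    linarith
  have hinj : ρ.support.InjOn k := by
    rw [hρ]
    intro a ha b hb hab
    simp only [hk, ha, hb, dif_pos] at hab
    exact congrArg Subtype.val (he hab)
  obtain ⟨ξ, hξ, h1, h2⟩ := exists_singular_of_perturb hg' hε hε1 h hζ hβ (by rwa [hρ]) hζu hβu
    hkm hinj hki le_rfl hm hlt
  refine ⟨_, ξ, ?_, integrable_perturb hε hd, hm, hξ, h1, h2⟩
  rw [NonDegenerateOn, support_perturb hg' hε hε1, hρ]
  exact congrArg _ (Subsemigroup.closure_eq Γ.toSubsemigroup)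

theorem exists_singular_on_subgroup (Γ : Subgroup Sol) (hΓ : (Γ : Set Sol).Countable)
    (hna : ∃ g ∈ Γ, ∃ h ∈ Γ, g * h ≠ h * g) :
    ∃ (μ : PMF Sol) (ν : Measure ℝ), NonDegenerateOn μ Γ ∧ HasFiniteFirstMoment μ ∧
      IsHarmonicMeasure μ ν ∧ (∀ t : ℝ, ν {t} = 0) ∧ ν ⟂ₘ (volume : Measure ℝ) := by
  obtain ⟨a, ha, b, hb, hab⟩ := hna
  by_cases hx : (a * b).x = (b * a).x
  · have hy : (a * b).y ≠ (b * a).y := fun hy =>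
      hab (Sol.ext (add_comm a.z b.z) hx hy)
    obtain ⟨μ, ξ, h1, h2, h3, h4, h5⟩ := exists_singular_on isAffineAction_neg_z_y hΓ ha hb hy
    refine ⟨μ, _, h1, h2, Or.inr ⟨?_, ξ, h4.measurable, h4.ae_tendsto, rfl⟩, h5⟩
    rwa [integral_neg, Left.neg_pos_iff] at h3
  · obtain ⟨μ, ξ, h1, h2, h3, h4, h5⟩ := exists_singular_on isAffineAction_z_x hΓ ha hb hx
    exact ⟨μ, _, h1, h2, Or.inl ⟨h3, ξ, h4.measurable, h4.ae_tendsto, rfl⟩, h5⟩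

/-! ### Singular harmonic measures with a given speed -/

/-- The uniform law on `g, g⁻¹, u, u⁻¹`. -/
noncomputable def symmetricLaw (g u : Sol) : PMF Sol :=
  mix 2⁻¹ (by simp) (mix 2⁻¹ (by simp) (PMF.pure g) (PMF.pure g⁻¹))
    (mix 2⁻¹ (by simp) (PMF.pure u) (PMF.pure u⁻¹))

theorem support_symmetricLaw (g u : Sol) :
    (symmetricLaw g u).support = ({g} ∪ {g⁻¹}) ∪ ({u} ∪ {u⁻¹}) := by
  have h0 : (2⁻¹ : ENNReal) ≠ 0 := by simp
  have h1 : (2⁻¹ : ENNReal) ≠ 1 := by simp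
  simp only [symmetricLaw, support_mix _ _ _ h0 h1, PMF.support_pure]

theorem finite_support_symmetricLaw (g u : Sol) : (symmetricLaw g u).support.Finite := by
  rw [support_symmetricLaw]
  exact ((Set.finite_singleton _).union (Set.finite_singleton _)).union
    ((Set.finite_singleton _).union (Set.finite_singleton _))

theorem integral_z_symmetricLaw (g u : Sol) : ∫ h, h.z ∂(symmetricLaw g u).toMeasure = 0 := by
  have hi : ∀ g : Sol, Integrable (fun h : Sol => h.z) (PMF.pure g).toMeasure := fun g =>
    integrable_of_finite_support _ (by simp) _
  rw [symmetricLaw, integral_mix _ _ _ (integrable_mix _ _ _ (hi _) (hi _))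
    (integrable_mix _ _ _ (hi _) (hi _)), integral_mix _ _ _ (hi _) (hi _),
    integral_mix _ _ _ (hi _) (hi _)]
  simp only [PMF.toMeasure_pure, integral_dirac, inv_def, ENNReal.toReal_inv,
    ENNReal.toReal_ofNat, smul_eq_mul]
  ring

theorem exists_singular_with_speed (α : ℝ) (hα : 0 < α) :
    ∃ (μ : PMF Sol) (ν : Measure ℝ), μ.support.Finite ∧ NonDegenerate μ ∧
      HasSpeed μ α ∧ IsHarmonicMeasure μ ν ∧ (∀ t : ℝ, ν {t} = 0) ∧
      ν ⟂ₘ (volume : Measure ℝ) := by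
  classical
  obtain ⟨ε, hε, hε1, hlt⟩ := exists_costBound_lt 3 α α hα
  rw [← add_mul, sub_add_cancel, one_mul] at hlt
  have hε1' : 1 - ε ≠ 0 := by linarith
  -- The symmetric part has no drift, so this translation length gives the drift `α`.
  set g : Sol := ⟨α / (1 - ε), 0, 0⟩ with hg
  set u : Sol := ⟨0, 1, 1⟩ with hu
  set ρ := symmetricLaw g u with hρ
  have hsupp : ρ.support = ({g} ∪ {g⁻¹}) ∪ ({u} ∪ {u⁻¹}) := support_symmetricLaw g u
  have hfin : ρ.support.Finite := finite_support_symmetricLaw g u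
  have hint := integrable_of_finite_support ρ hfin
  have hgs : g ∈ ρ.support := by
    rw [hsupp]
    exact Or.inl (Or.inl rfl)
  have hus : u ∈ ρ.support := by
    rw [hsupp]
    exact Or.inr (Or.inl rfl)
  have hs := support_perturb hgs hε hε1
  have hdrift : drift (perturb g ρ ε hε) = α := by
    rw [drift, integral_perturb hε hε1 (hint _), integral_z_symmetricLaw, mul_zero, add_zero,
      mul_div_cancel₀ _ hε1']
  set k : Sol → ℕ := fun h => if h = g then 0 else if h = g⁻¹ then 1 else if h = u then 2 else 3
    with hk
  have hkm : Measurable k :=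
    Measurable.ite (measurableSet_singleton _) measurable_const
      (Measurable.ite (measurableSet_singleton _) measurable_const
        (Measurable.ite (measurableSet_singleton _) measurable_const measurable_const))
  have hk3 : ∀ h, k h ≤ 3 := fun h => by
    simp only [hk]
    split_ifs <;> norm_num
  have hinj : ρ.support.InjOn k := by
    refine Set.LeftInvOn.injOn (f₁' := fun n => if n = 0 then g else if n = 1 then g⁻¹ else
      if n = 2 then u else u⁻¹) fun h hh => ?_
    rw [hsupp] at hh
    simp only [hk]
    split_ifs with h1 h2 h3 <;> simp_all
  have hK : ∫ h, (k h : ℝ) ∂ρ.toMeasure ≤ 3 := by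
    refine (integral_mono (hint _) (integrable_const 3) fun h => ?_).trans (by simp)
    show (k h : ℝ) ≤ 3
    exact_mod_cast hk3 h
  have hm : 0 < drift (perturb g ρ ε hε) := by rwa [hdrift]
  obtain ⟨ξ, hξ, h1, h2⟩ := exists_singular_of_perturb hgs hε hε1 isAffineAction_z_x (hint _)
    (hint _) hus rfl one_ne_zero hkm hinj (hint _) hK hm (hlt.trans_eq hdrift.symm)
  refine ⟨perturb g ρ ε hε, _, hs ▸ hfin, nonDegenerate_of_inv_mem ?_, ?_,
    Or.inl ⟨hm, ξ, hξ.measurable, hξ.ae_tendsto, rfl⟩, h1, h2⟩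
  · rw [hs, hsupp]
    intro h hh
    refine Subsemigroup.subset_closure ?_
    rcases hh with (rfl | rfl) | rfl | rfl <;> simp
  · have := hasSpeed_drift (hs ▸ hfin) hm
    rwa [hdrift] at this

end Sol

theorem theorem1p1 :
    (∀ Γ : Subgroup Sol, (Γ : Set Sol).Countable → (∃ g ∈ Γ, ∃ h ∈ Γ, g * h ≠ h * g) →
      ∃ (μ : PMF Sol) (ν : Measure ℝ), Sol.NonDegenerateOn μ Γ ∧ Sol.HasFiniteFirstMoment μ ∧
        Sol.IsHarmonicMeasure μ ν ∧ (∀ t : ℝ, ν {t} = 0) ∧ ν ⟂ₘ (volume : Measure ℝ)) ∧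
    (∃ (μ : PMF Sol) (ν : Measure ℝ), μ.support.Finite ∧ Sol.NonDegenerate μ ∧
      Sol.IsHarmonicMeasure μ ν ∧ ν ≪ (volume : Measure ℝ)) ∧
    (∀ k : ℕ, ∃ (μ : PMF Sol) (ν : Measure ℝ), μ.support.Finite ∧ Sol.NonDegenerate μ ∧
      Sol.IsHarmonicMeasure μ ν ∧
      ∃ f : ℝ → ℝ, ContDiff ℝ k f ∧ (∀ t, 0 ≤ f t) ∧
        ν = (volume : Measure ℝ).withDensity (fun t => ENNReal.ofReal (f t))) ∧
    (∀ α : ℝ, 0 < α → ∃ (μ : PMF Sol) (ν : Measure ℝ), μ.support.Finite ∧ Sol.NonDegenerate μ ∧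
      Sol.HasSpeed μ α ∧ Sol.IsHarmonicMeasure μ ν ∧ (∀ t : ℝ, ν {t} = 0) ∧ ν ⟂ₘ (volume : Measure ℝ)) := by
  refine ⟨Sol.exists_singular_on_subgroup, ?_, Sol.exists_smooth_harmonic,
    Sol.exists_singular_with_speed⟩
  obtain ⟨μ, ν, h1, h2, h3, f, -, -, rfl⟩ := Sol.exists_smooth_harmonic 0
  exact ⟨μ, _, h1, h2, h3, withDensity_absolutelyContinuous _ _⟩
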